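/- Let $d,k\ge 1$, let $\alpha,\beta>0$, $\lambda\ge 0$, $h_{\min}>0$, and let $\sigma$ be a shape-regularity parameter. There is a number $\rho\in(0,1)$ that depends only on $d$, $k$, $\sigma$, $\alpha$, $\beta$, $\lambda$, $h_{\min}$ and, in the case $\lambda=0$, on the domain $\Omega$, such that the following holds. Let $\Omega\subset\mathbb R^d$ be a bounded polyhedral domain and $\mathcal T_h$ an affine matching simplicial mesh of $\Omega$ whose minimal cell diameter is $h_{\min}$ and in which every cell $K$ satisfies $\operatorname{diam}K\le\sigma\rho_K$, where $\rho_K$ is the diameter of the largest ball in $\overline K$. Let $\Gamma\subseteq\partial\Omega$, and let $\lambda>0$ or $\partial\Omega\setminus\Gamma\ne\emptyset$. Let $A\in L^\infty(\Omega,\mathbb R^{d\times d})$ satisfy $A(x)\xi\cdot\xi\ge\alpha|\xi|^2$ and $|A(x)\xi|\le\beta|\xi|$ for all $\xi\in\mathbb R^d$ and almost every $x\in\Omega$ (for symmetric $A$: $\alpha I\le A(x)\le\beta I$). Let $P_k(\mathcal T_h)$ be the space of continuous functions on $\overline\Omega$ that are polynomials of degree at most $k$ on each cell, and $P_{k,0}(\mathcal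 T_h)$ the subspace of functions that vanish on $\partial\Omega$. Let $u_{hg}\in P_k(\mathcal T_h)$ be a lifting of discrete boundary data $g_h$, that is, $u_{hg}|_{\partial\Omega}=g_h$, and let $u_h\in P_k(\mathcal T_h)$ be the solution of the discrete problem: $u_{h0}=u_h-u_{hg}\in P_{k,0}(\mathcal T_h)$ and $$\int_\Omega A\nabla u_{h0}\cdot\nabla v_h\,dx+\lambda^2\int_\Omega u_{h0}v_h\,dx=-\int_\Omega A\nabla u_{hg}\cdot\nabla v_h\,dx-\lambda^2\int_\Omega u_{hg}v_h\,dx\qquad\text{for all } v_h\in P_{k,0}(\mathcal T_h).$$ Let $D_h\subseteq\mathcal T_h$ be suitable, that is, $\Gamma\cap\overline K=\emptyset$ for all $K\in D_h$. Put $N^0(D_h)=D_h$ and let $N^{\ell}(D_h)$ be the set of all $K\in\mathcal T_h$ for which $\overline K$ meets $\overline{K'}$ for some $K'\in N^{\ell-1}(D_h)$. Let $$\ell_{\max}=\max\{\ell\in\mathbb N_0:\ \overline K\cap\operatorname{supp}u_{hg}=\emptyset\ \text{ for all }K\in N^\ell(D_h)\}$$ (assuming that this maximum exists), and define $$E(\ell)=\sum_{K\in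 N^\ell(D_h)}\Big(\int_K A\nabla u_h\cdot\nabla u_h\,dx+\lambda^2\int_K u_h^2\,dx\Big),\qquad |||u_h|||_\Omega^2=\int_\Omega A\nabla u_h\cdot\nabla u_h\,dx+\lambda^2\int_\Omega u_h^2\,dx .$$ Then $$E(\ell)\le\rho\,E(\ell+1)\quad\text{for } 0\le\ell<\ell_{\max},\qquad\text{and}\qquad E(0)\le\rho^{\ell_{\max}}E(\ell_{\max})\le\rho^{\ell_{\max}}|||u_h|||_\Omega^2 .$$ -/

import Mathlib

noncomputable section

namespace FEM

open MeasureTheory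

abbrev Pt (d : ℕ) := EuclideanSpace ℝ (Fin d)

/-- A bounded polyhedral domain: a bounded, open, connected set that is the interior of its
closure and whose closure is a finite union of simplices. (Lipschitz polyhedra are of this kind.) -/
structure IsPolyhedralDomain {d : ℕ} (Ω : Set (Pt d)) : Prop where
  isOpen : IsOpen Ω
  isConnected : IsConnected Ω
  isBounded : Bornology.IsBounded Ω
  interior_closure : interior (closure Ω) = Ω
  polyhedral : ∃ S : Finset (Finset (Pt d)),
    closure Ω = ⋃ s ∈ S, convexHull ℝ (s : Set (Pt d))

/-- An affine, matching simplicial mesh of `Ω`. A cell is given by its `d + 1` vertices; the closed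
simplex that they span is `cell s`. Two closed cells meet in the simplex spanned by their common
vertices (which is empty if there are none). -/
structure SimplicialMesh {d : ℕ} (Ω : Set (Pt d)) where
  cells : Finset (Finset (Pt d))
  card_eq : ∀ s ∈ cells, s.card = d + 1
  affineIndependent : ∀ s ∈ cells, AffineIndependent ℝ (fun p : s => (p : Pt d))
  matching : ∀ s ∈ cells, ∀ t ∈ cells,
    convexHull ℝ (s : Set (Pt d)) ∩ convexHull ℝ (t : Set (Pt d)) =
      convexHull ℝ ((s : Set (Pt d)) ∩ (t : Set (Pt d)))
  iUnion_eq : ⋃ s ∈ cells, convexHull ℝ (s : Set (Pt d)) = closure Ω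

/-- The closed simplex with vertex set `s`. -/
def cell {d : ℕ} (s : Finset (Pt d)) : Set (Pt d) := convexHull ℝ (s : Set (Pt d))

/-- The minimal diameter `h_min` of the cells (a minimum over a finite set). -/
def SimplicialMesh.hMin {d : ℕ} {Ω : Set (Pt d)} (T : SimplicialMesh Ω) : ℝ :=
  sInf ((fun s : Finset (Pt d) => Metric.diam (cell s)) '' (T.cells : Set (Finset (Pt d))))

/-- Shape regularity with parameter `σ`: the diameter of each cell is at most `σ` times the
diameter `2 r` of the largest ball contained in it. -/
def SimplicialMesh.ShapeRegular {d : ℕ} {Ω : Set (Pt d)} (T : SimplicialMesh Ω) (σ : ℝ) : Prop :=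
  ∀ s ∈ T.cells, ∃ (c : Pt d) (r : ℝ), 0 < r ∧ Metric.closedBall c r ⊆ cell s ∧
    Metric.diam (cell s) ≤ σ * (2 * r)

/-- The Lagrange space: functions that are continuous on the closure of `Ω` and on each cell agree
with a polynomial in `d` variables of total degree at most `k`. Values outside the closure of `Ω`
play no role anywhere below. -/
def SimplicialMesh.Pk {d : ℕ} {Ω : Set (Pt d)} (T : SimplicialMesh Ω) (k : ℕ) :
    Set (Pt d → ℝ) :=
  {u | ContinuousOn u (closure Ω) ∧ ∀ s ∈ T.cells, ∃ p : MvPolynomial (Fin d) ℝ,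
    p.totalDegree ≤ k ∧ ∀ x ∈ cell s, u x = MvPolynomial.eval (fun i => x i) p}

/-- The functions of the Lagrange space with zero trace on the boundary. -/
def SimplicialMesh.PkZero {d : ℕ} {Ω : Set (Pt d)} (T : SimplicialMesh Ω) (k : ℕ) :
    Set (Pt d → ℝ) :=
  {u | u ∈ T.Pk k ∧ ∀ x ∈ frontier Ω, u x = 0}

/-- A measurable coefficient matrix on `Ω` with ellipticity constant `α` and bound `β`, almost
everywhere in `Ω`. For symmetric matrices the two bounds together say `α I ≤ A x ≤ β I`. -/
structure IsCoefficient {d : ℕ} (Ω : Set (Pt d)) (α β : ℝ)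
    (A : Pt d → Matrix (Fin d) (Fin d) ℝ) : Prop where
  aemeasurable : ∀ i j, AEMeasurable (fun x => A x i j) (volume.restrict Ω)
  lower : ∀ᵐ x ∂(volume.restrict Ω), ∀ ξ : Pt d,
    α * ‖ξ‖ ^ 2 ≤ inner ℝ (Matrix.toEuclideanLin (A x) ξ) ξ
  upper : ∀ᵐ x ∂(volume.restrict Ω), ∀ ξ : Pt d, ‖Matrix.toEuclideanLin (A x) ξ‖ ≤ β * ‖ξ‖

/-- `∫_S A ∇u · ∇v`. Functions of the Lagrange space are differentiable in the interior of each
cell, so their classical gradient exists almost everywhere and is their weak gradient. -/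
def aForm {d : ℕ} (A : Pt d → Matrix (Fin d) (Fin d) ℝ) (S : Set (Pt d)) (u v : Pt d → ℝ) : ℝ :=
  ∫ x in S, inner ℝ (Matrix.toEuclideanLin (A x) (gradient u x)) (gradient v x)

/-- The `L²` inner product on `S`. -/
def l2Form {d : ℕ} (S : Set (Pt d)) (u v : Pt d → ℝ) : ℝ := ∫ x in S, u x * v x

/-- The squared energy norm on `S`. -/
def energyNormSq {d : ℕ} (A : Pt d → Matrix (Fin d) (Fin d) ℝ) (lam : ℝ) (S : Set (Pt d))
    (u : Pt d → ℝ) : ℝ :=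
  aForm A S u u + lam ^ 2 * l2Form S u u

/-- `uhg` is a discrete lifting of the discrete boundary datum `gh`. -/
def SimplicialMesh.IsLifting {d : ℕ} {Ω : Set (Pt d)} (T : SimplicialMesh Ω) (k : ℕ)
    (gh : frontier Ω → ℝ) (uhg : Pt d → ℝ) : Prop :=
  uhg ∈ T.Pk k ∧ ∀ x : frontier Ω, uhg x = gh x

/-- `uh` solves the discrete problem with lifting `uhg`, the unknown being `uh - uhg`. -/
def SimplicialMesh.IsSolution {d : ℕ} {Ω : Set (Pt d)} (T : SimplicialMesh Ω) (k : ℕ)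
    (A : Pt d → Matrix (Fin d) (Fin d) ℝ) (lam : ℝ) (uhg uh : Pt d → ℝ) : Prop :=
  uh ∈ T.Pk k ∧ uh - uhg ∈ T.PkZero k ∧
    ∀ v ∈ T.PkZero k, aForm A Ω (uh - uhg) v + lam ^ 2 * l2Form Ω (uh - uhg) v =
      -aForm A Ω uhg v - lam ^ 2 * l2Form Ω uhg v

/-- A set of cells is suitable if none of its closed cells meets `Γ`. -/
def Suitable {d : ℕ} (Γ : Set (Pt d)) (D : Finset (Finset (Pt d))) : Prop :=
  ∀ s ∈ D, Γ ∩ cell s = ∅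

open Classical in
/-- The patch of size `l` around `D`. -/
def SimplicialMesh.patch {d : ℕ} {Ω : Set (Pt d)} (T : SimplicialMesh Ω)
    (D : Finset (Finset (Pt d))) : ℕ → Finset (Finset (Pt d))
  | 0 => D
  | l + 1 => T.cells.filter (fun s => ∃ t ∈ T.patch D l, (cell s ∩ cell t).Nonempty)

/-- The (closed) support of a function on `Ω`. -/
def supportIn {d : ℕ} (Ω : Set (Pt d)) (u : Pt d → ℝ) : Set (Pt d) :=
  closure {x | x ∈ Ω ∧ u x ≠ 0}

/-- `lmax` is the largest `l` for which no closed cell of the patch of size `l` meets the support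
of the lifting. -/
def SimplicialMesh.IsMaxPatchSize {d : ℕ} {Ω : Set (Pt d)} (T : SimplicialMesh Ω)
    (D : Finset (Finset (Pt d))) (uhg : Pt d → ℝ) (lmax : ℕ) : Prop :=
  IsGreatest {l : ℕ | ∀ s ∈ T.patch D l, cell s ∩ supportIn Ω uhg = ∅} lmax

/-- The discrete energy in the patch of size `l` around `D`. -/
def SimplicialMesh.energy {d : ℕ} {Ω : Set (Pt d)} (T : SimplicialMesh Ω)
    (A : Pt d → Matrix (Fin d) (Fin d) ℝ) (lam : ℝ) (uh : Pt d → ℝ)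
    (D : Finset (Finset (Pt d))) (l : ℕ) : ℝ :=
  ∑ s ∈ T.patch D l, energyNormSq A lam (cell s) uh

end FEM

end

/-!
The solution `u` is tested with a cut-off `v` of itself. Let `V` be the set of vertices of the patch
of size `l`. On a cell, `u` is a homogeneous polynomial of degree `k` in the barycentric
coordinates, and `v` arises from it by setting the coordinates of the vertices outside `V` to zero.
Explicitly `v x = m ^ k * u (y / m)`, where `m` is the sum of the coordinates of `x` that belong to
`V`, and `y` is the combination of the vertices in `V` with these coordinates. In this form it is
plain that `v` is again in the Lagrange space, agrees with `u` on the patch of size `l`, vanishes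
outside the patch of size `l + 1`, and is bounded on each cell by the maximum of `u` there
(`exists_cutoff`). It also vanishes on the boundary of the domain, because `y / m` lies in the
smallest face that contains `x`, and with a boundary point the whole of this face belongs to the
boundary (`mem_frontier_of_bary`).

Since `u` is orthogonal to `v`, the energy in the inner patch is bounded by integrals over the layer
between the two patches. By Young's inequality an estimate of `v` in the layer by the energy in the
outer patch suffices for a reduction factor less than one (`energy_le_reductionFactor_mul`).

The estimate of `v` rests on inequalities for polynomials on convex sets which follow from Markov's
inequality in one variable: the maximum is bounded by the `L²` norm (`sq_mul_volume_le`), and the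
gradient by the maximum divided by the inradius (`norm_polyGrad_le`). For `λ > 0` the energy
contains the `L²` norm, and the estimate is local in each cell. For `λ = 0` a constant is first
subtracted from `u` on each connected component of the outer patch, namely zero if the component
touches the boundary. What remains is bounded by the `L²` norm of the gradient by summing
oscillations along chains of cells (`exists_constants_sub_le`). The number of cells, hence the
length of a chain, is bounded in terms of the volume of the domain, which is where the domain
enters the constant.
-/

noncomputable section

namespace FEM

open MeasureTheory

/-! ### Polynomial functions -/

/-- The function on Euclidean space defined by a polynomial in `d` variables. -/
def polyFun {d : ℕ} (p : MvPolynomial (Fin d) ℝ) (x : Pt d) : ℝ :=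
  MvPolynomial.eval (fun i => x i) p

/-- The polynomial of the derivative in direction `w`. -/
def dirDeriv {d : ℕ} (w : Pt d) (p : MvPolynomial (Fin d) ℝ) : MvPolynomial (Fin d) ℝ :=
  ∑ i, MvPolynomial.C (w i) * MvPolynomial.pderiv i p

lemma totalDegree_pderiv_le {d k : ℕ} {p : MvPolynomial (Fin d) ℝ} (hp : p.totalDegree ≤ k)
    (i : Fin d) : (MvPolynomial.pderiv i p).totalDegree ≤ k := by
  rw [p.as_sum, map_sum]
  refine MvPolynomial.totalDegree_finsetSum_le fun s hs => ?_
  rw [MvPolynomial.pderiv_monomial]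
  refine (MvPolynomial.totalDegree_monomial_le _ _).trans ?_
  refine le_trans ?_ ((MvPolynomial.le_totalDegree hs).trans hp)
  exact Finsupp.degree_mono (tsub_le_self : s - Finsupp.single i 1 ≤ s)

lemma totalDegree_dirDeriv_le {d k : ℕ} {p : MvPolynomial (Fin d) ℝ} (hp : p.totalDegree ≤ k)
    (w : Pt d) : (dirDeriv w p).totalDegree ≤ k := by
  refine MvPolynomial.totalDegree_finsetSum_le fun i _ => ?_
  refine (MvPolynomial.totalDegree_mul _ _).trans ?_
  rw [MvPolynomial.totalDegree_C, zero_add]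
  exact totalDegree_pderiv_le hp i

lemma polyFun_dirDeriv {d : ℕ} (w : Pt d) (p : MvPolynomial (Fin d) ℝ) (x : Pt d) :
    polyFun (dirDeriv w p) x = ∑ i, w i * polyFun (MvPolynomial.pderiv i p) x := by
  simp [polyFun, dirDeriv]

/-- The gradient of a polynomial function, assembled from the formal partial derivatives. -/
def polyGrad {d : ℕ} (p : MvPolynomial (Fin d) ℝ) (x : Pt d) : Pt d :=
  WithLp.toLp 2 fun i => polyFun (MvPolynomial.pderiv i p) x

lemma inner_polyGrad {d : ℕ} (p : MvPolynomial (Fin d) ℝ) (x w : Pt d) :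
    inner ℝ (polyGrad p x) w = polyFun (dirDeriv w p) x := by
  simp [polyFun_dirDeriv, polyGrad, PiLp.inner_apply]

lemma hasGradientAt_polyFun {d : ℕ} (p : MvPolynomial (Fin d) ℝ) (x : Pt d) :
    HasGradientAt (polyFun p) (polyGrad p x) x := by
  rw [hasGradientAt_iff_hasFDerivAt]
  induction p using MvPolynomial.induction_on with
  | C a =>
    have h : polyFun (MvPolynomial.C a : MvPolynomial (Fin d) ℝ) = fun _ => a := by
      ext; simp [polyFun]
    rw [h]
    refine (hasFDerivAt_const a x).congr_fderiv ?_
    ext w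
    rw [InnerProductSpace.toDual_apply_apply, inner_polyGrad, polyFun_dirDeriv]
    simp [polyFun]
  | add p q hp hq =>
    have h : polyFun (p + q) = fun y => polyFun p y + polyFun q y := by
      ext; simp [polyFun]
    rw [h]
    refine (hp.add hq).congr_fderiv ?_
    ext w
    simp only [add_apply, InnerProductSpace.toDual_apply_apply, inner_polyGrad, polyFun_dirDeriv]
    simp [polyFun, mul_add, Finset.sum_add_distrib]
  | mul_X p n hp =>
    have h : polyFun (p * MvPolynomial.X n) = fun y => polyFun p y * y n := by
      ext; simp [polyFun]
    rw [h]
    have hn : HasFDerivAt (fun y : Pt d => y n) (EuclideanSpace.proj n : Pt d →L[ℝ] ℝ) x :=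
      (EuclideanSpace.proj n : Pt d →L[ℝ] ℝ).hasFDerivAt
    refine (hp.mul hn).congr_fderiv ?_
    ext w
    simp only [add_apply, smul_apply, InnerProductSpace.toDual_apply_apply, inner_polyGrad,
      polyFun_dirDeriv]
    simp only [polyFun, Derivation.leibniz, MvPolynomial.pderiv_X, smul_eq_mul, map_add, map_mul,
      MvPolynomial.eval_X, mul_add, Finset.sum_add_distrib, Finset.mul_sum]
    congr 1
    · rw [Finset.sum_eq_single n]
      · simp [mul_comm]
      · intro b _ hb
        simp [hb.symm]
      · simp
    · exact Finset.sum_congr rfl fun i _ => by ring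

lemma continuous_polyFun {d : ℕ} (p : MvPolynomial (Fin d) ℝ) : Continuous (polyFun p) :=
  continuous_iff_continuousAt.2 fun x =>
    ((hasGradientAt_iff_hasFDerivAt.1 (hasGradientAt_polyFun p x))).continuousAt

lemma continuous_polyGrad {d : ℕ} (p : MvPolynomial (Fin d) ℝ) : Continuous (polyGrad p) := by
  unfold polyGrad
  have h : Continuous fun x : Pt d => fun i => polyFun (MvPolynomial.pderiv i p) x :=
    continuous_pi fun i => continuous_polyFun _
  exact (PiLp.continuous_toLp 2 _).comp h

/-- On a line, a polynomial function is a univariate polynomial of no larger degree, and its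
derivative is the directional derivative. -/
lemma exists_polynomial_on_line {d k : ℕ} {p : MvPolynomial (Fin d) ℝ} (hp : p.totalDegree ≤ k)
    (x w : Pt d) : ∃ q : Polynomial ℝ, q.natDegree ≤ k ∧
      (∀ t : ℝ, polyFun p (x + t • w) = q.eval t) ∧
      ∀ t : ℝ, polyFun (dirDeriv w p) (x + t • w) = q.derivative.eval t := by
  set q : Polynomial ℝ := MvPolynomial.aeval
    (fun i => Polynomial.C (x i) + Polynomial.C (w i) * Polynomial.X) p with hq
  have hev : ∀ t : ℝ, polyFun p (x + t • w) = q.eval t := by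
    intro t
    rw [hq, ← Polynomial.coe_evalRingHom, MvPolynomial.aeval_def, MvPolynomial.hom_eval₂, polyFun,
      MvPolynomial.eval, MvPolynomial.coe_eval₂Hom]
    congr 1
    · exact RingHom.ext fun a => Polynomial.eval_C.symm
    · funext i
      simp only [PiLp.add_apply, PiLp.smul_apply, smul_eq_mul, Polynomial.coe_evalRingHom,
        Polynomial.eval_add, Polynomial.eval_mul, Polynomial.eval_C, Polynomial.eval_X]
      ring
  refine ⟨q, ?_, hev, fun t => ?_⟩
  · have := MvPolynomial.aeval_natDegree_le p hp
      (fun i => Polynomial.C (x i) + Polynomial.C (w i) * Polynomial.X) (n := 1)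
      (fun i => by compute_degree)
    simpa using this
  · have h1 : HasDerivAt (fun t : ℝ => x + t • w) w t := by
      simpa using ((hasDerivAt_id t).smul_const w).const_add x
    have h2 := (hasGradientAt_iff_hasFDerivAt.1
      (hasGradientAt_polyFun p (x + t • w))).comp_hasDerivAt t h1
    have h3 : HasDerivAt (fun t : ℝ => q.eval t)
        (polyFun (dirDeriv w p) (x + t • w)) t := by
      simpa only [Function.comp_def, hev, InnerProductSpace.toDual_apply_apply, inner_polyGrad]
        using h2
    exact h3.unique (q.hasDerivAt t)

/-! ### Markov and inverse inequalities on convex sets -/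

/-- A constant in Markov's inequality at an end point of the unit interval, read off from Lagrange
interpolation at the nodes `i / (k + 1)`, `0 ≤ i ≤ k`. The summand `1` only makes it at least
`1`. -/
def markovConst (k : ℕ) : ℝ :=
  1 + ∑ i ∈ Finset.range (k + 1), |(Lagrange.basis (Finset.range (k + 1))
    (fun j : ℕ => (j : ℝ) / (k + 1)) i).derivative.eval 0|

lemma one_le_markovConst (k : ℕ) : 1 ≤ markovConst k :=
  le_add_of_nonneg_right (Finset.sum_nonneg fun _ _ => abs_nonneg _)

lemma abs_derivative_eval_zero_le {k : ℕ} {q : Polynomial ℝ} (hq : q.natDegree ≤ k) {S : ℝ}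
    (hS : ∀ t ∈ Set.Icc (0 : ℝ) 1, |q.eval t| ≤ S) :
    |q.derivative.eval 0| ≤ markovConst k * S := by
  have hk : (0 : ℝ) < k + 1 := by positivity
  have hinj : Set.InjOn (fun j : ℕ => (j : ℝ) / (k + 1)) (Finset.range (k + 1)) := by
    intro a _ b _ hab
    have : (a : ℝ) / (k + 1) = b / (k + 1) := hab
    field_simp at this
    exact_mod_cast this
  have hdeg : q.degree < (Finset.range (k + 1)).card := by
    rw [Finset.card_range]
    exact lt_of_le_of_lt Polynomial.degree_le_natDegree (by exact_mod_cast Nat.lt_succ_of_le hq)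
  have hS0 : 0 ≤ S := (abs_nonneg _).trans (hS 0 (by simp))
  have h := congrArg (fun r : Polynomial ℝ => r.derivative.eval 0)
    (Lagrange.eq_interpolate hinj hdeg)
  simp only [Lagrange.interpolate_apply, Polynomial.derivative_sum, Polynomial.eval_finsetSum,
    Polynomial.derivative_C_mul, Polynomial.eval_C_mul] at h
  rw [h]
  refine (Finset.abs_sum_le_sum_abs _ _).trans ?_
  rw [markovConst, add_mul, one_mul, Finset.sum_mul]
  refine le_add_of_nonneg_of_le hS0 (Finset.sum_le_sum fun i hi => ?_)
  rw [abs_mul, mul_comm]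
  refine mul_le_mul_of_nonneg_left (hS _ ⟨by positivity, ?_⟩) (abs_nonneg _)
  rw [div_le_one hk]
  have := Finset.mem_range.1 hi
  exact_mod_cast this.le

/-- Markov's inequality on a convex set, in the directions that are differences of two points of
the set. The derivative in direction `y - z` is the difference of the derivatives along the segments
from `x` to `y` and from `x` to `z`, which are bounded by the inequality in one variable. -/
lemma abs_dirDeriv_le {d k : ℕ} {p : MvPolynomial (Fin d) ℝ} (hp : p.totalDegree ≤ k)
    {K : Set (Pt d)} (hK : Convex ℝ K) {S : ℝ} (hS : ∀ x ∈ K, |polyFun p x| ≤ S)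
    {x y z : Pt d} (hx : x ∈ K) (hy : y ∈ K) (hz : z ∈ K) :
    |polyFun (dirDeriv (y - z) p) x| ≤ 2 * markovConst k * S := by
  have key : ∀ y ∈ K, |polyFun (dirDeriv (y - x) p) x| ≤ markovConst k * S := by
    intro y hy
    obtain ⟨q, hq, h1, h2⟩ := exists_polynomial_on_line hp x (y - x)
    have h0 := h2 0
    rw [zero_smul, add_zero] at h0
    rw [h0]
    refine abs_derivative_eval_zero_le hq fun t ht => ?_
    rw [← h1]
    exact hS _ (hK.add_smul_sub_mem hx hy ht)
  have hsub : polyFun (dirDeriv (y - z) p) x =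
      polyFun (dirDeriv (y - x) p) x - polyFun (dirDeriv (z - x) p) x := by
    simp only [← inner_polyGrad, ← inner_sub_right]
    congr 1
    abel
  rw [hsub]
  refine (abs_sub _ _).trans ?_
  linarith [key y hy, key z hz]

/-- The inverse inequality for the gradient on a convex set that contains a ball of radius `r`. -/
lemma norm_polyGrad_le {d k : ℕ} {p : MvPolynomial (Fin d) ℝ} (hp : p.totalDegree ≤ k)
    {K : Set (Pt d)} (hK : Convex ℝ K) {S : ℝ} (hS : ∀ x ∈ K, |polyFun p x| ≤ S)
    {c : Pt d} {r : ℝ} (hr : 0 < r) (hball : Metric.closedBall c r ⊆ K)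
    {x : Pt d} (hx : x ∈ K) : ‖polyGrad p x‖ ≤ markovConst k * S / r := by
  rcases eq_or_ne (polyGrad p x) 0 with h0 | h0
  · rw [h0, norm_zero]
    have := (abs_nonneg _).trans (hS x hx)
    have := one_le_markovConst k
    positivity
  have hn : 0 < ‖polyGrad p x‖ := norm_pos_iff.2 h0
  set g := polyGrad p x with hg
  set w : Pt d := (r / ‖g‖) • g with hw
  have hwn : ‖w‖ = r := by
    rw [hw, norm_smul, Real.norm_of_nonneg (by positivity)]
    field_simp
  have h := abs_dirDeriv_le hp hK hS hx (y := c + w) (z := c - w)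
    (hball (by simp [hwn])) (hball (by simp [hwn]))
  have h2 : polyFun (dirDeriv (c + w - (c - w)) p) x = 2 * (r * ‖g‖) := by
    rw [← inner_polyGrad, ← hg, show c + w - (c - w) = (2 : ℝ) • w by rw [two_smul]; abel, hw,
      inner_smul_right, inner_smul_right, real_inner_self_eq_norm_sq]
    field_simp
  rw [h2, abs_of_pos (by positivity)] at h
  rw [le_div_iff₀ hr]
  linarith

/-- The constant in the estimate of the maximum of a polynomial by its `L²` norm. -/
def supConst (d k : ℕ) : ℝ := 4 * (4 * markovConst k) ^ d

lemma supConst_pos (d k : ℕ) : 0 < supConst d k := by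
  have := one_le_markovConst k
  unfold supConst
  positivity

/-- The maximum of a polynomial on a compact convex set is bounded by its mean square. If the
maximum is attained at `x₀`, then by Markov's inequality the polynomial is at least half as large
on a copy of `K` that is shrunk towards `x₀` by a factor which depends on the degree only. -/
lemma sq_mul_volume_le {d k : ℕ} {p : MvPolynomial (Fin d) ℝ} (hp : p.totalDegree ≤ k)
    {K : Set (Pt d)} (hK : Convex ℝ K) (hKc : IsCompact K) {x : Pt d} (hx : x ∈ K) :
    polyFun p x ^ 2 * volume.real K ≤ supConst d k * ∫ y in K, polyFun p y ^ 2 := by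
  obtain ⟨x₀, hx₀, hmax⟩ := hKc.exists_isMaxOn ⟨x, hx⟩
    ((continuous_polyFun p).abs.continuousOn)
  set S := |polyFun p x₀| with hSdef
  have hS : ∀ y ∈ K, |polyFun p y| ≤ S := fun y hy => hmax hy
  set M := markovConst k with hM
  have hM1 : 1 ≤ M := one_le_markovConst k
  have hS0 : 0 ≤ S := abs_nonneg _
  set τ : ℝ := 1 / (4 * M) with hτ
  have hτ0 : 0 < τ := by positivity
  have hτ1 : τ ≤ 1 := by
    rw [hτ, div_le_one (by positivity)]; linarith
  set H := AffineMap.homothety x₀ τ '' K with hH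
  have hHK : H ⊆ K := by
    rintro _ ⟨y, hy, rfl⟩
    rw [AffineMap.homothety_apply, vsub_eq_sub, vadd_eq_add, add_comm]
    exact hK.add_smul_sub_mem hx₀ hy ⟨hτ0.le, hτ1⟩
  have hlow : ∀ y ∈ H, (S / 2) ^ 2 ≤ polyFun p y ^ 2 := by
    rintro _ ⟨y, hy, rfl⟩
    rw [AffineMap.homothety_apply, vsub_eq_sub, vadd_eq_add, add_comm]
    obtain ⟨q, -, h1, h2⟩ := exists_polynomial_on_line hp x₀ (y - x₀)
    have hb : ∀ t ∈ Set.Icc (0 : ℝ) 1, ‖q.derivative.eval t‖ ≤ 2 * M * S := by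
      intro t ht
      rw [← h2, Real.norm_eq_abs]
      exact abs_dirDeriv_le hp hK hS (hK.add_smul_sub_mem hx₀ hy ht) hy hx₀
    have hdist := (convex_Icc (0 : ℝ) 1).norm_image_sub_le_of_norm_hasDerivWithin_le
      (f := fun t => q.eval t) (f' := fun t => q.derivative.eval t)
      (fun t _ => (q.hasDerivAt t).hasDerivWithinAt) hb
      (show (0 : ℝ) ∈ Set.Icc (0 : ℝ) 1 by simp) (show τ ∈ Set.Icc (0 : ℝ) 1 from ⟨hτ0.le, hτ1⟩)
    have e0 := h1 0
    rw [zero_smul, add_zero] at e0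
    simp only [← h1 τ, ← e0, sub_zero, Real.norm_eq_abs] at hdist
    rw [abs_of_pos hτ0] at hdist
    have e1 : 2 * M * S * τ = S / 2 := by rw [hτ]; field_simp; ring
    rw [e1] at hdist
    rw [← sq_abs (polyFun p _)]
    have h3 := abs_sub_abs_le_abs_sub (polyFun p x₀) (polyFun p (x₀ + τ • (y - x₀)))
    rw [abs_sub_comm] at h3
    refine pow_le_pow_left₀ (by positivity) ?_ 2
    linarith
  have hHc : IsCompact H := hKc.image (AffineMap.homothety_continuous x₀ τ)
  have hint : IntegrableOn (fun y => polyFun p y ^ 2) K :=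
    ((continuous_polyFun p).pow 2).continuousOn.integrableOn_compact hKc
  have hvolH : volume.real H = τ ^ d * volume.real K := by
    rw [measureReal_def, hH, Measure.addHaar_image_homothety, ENNReal.toReal_mul,
      ENNReal.toReal_ofReal (abs_nonneg _), finrank_euclideanSpace_fin,
      abs_of_pos (by positivity), ← measureReal_def]
  have h1 : (S / 2) ^ 2 * volume.real H ≤ ∫ y in K, polyFun p y ^ 2 := by
    calc (S / 2) ^ 2 * volume.real H = ∫ _ in H, (S / 2) ^ 2 := by
          rw [setIntegral_const, smul_eq_mul, mul_comm]
      _ ≤ ∫ y in H, polyFun p y ^ 2 :=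
          setIntegral_mono_on (integrableOn_const hHc.measure_lt_top.ne) (hint.mono_set hHK)
            hHc.measurableSet hlow
      _ ≤ ∫ y in K, polyFun p y ^ 2 :=
          setIntegral_mono_set hint (ae_of_all _ fun _ => sq_nonneg _) hHK.eventuallyLE
  have h2 : polyFun p x ^ 2 ≤ S ^ 2 := by
    rw [← sq_abs]
    exact pow_le_pow_left₀ (abs_nonneg _) (hS x hx) 2
  have hc : supConst d k * τ ^ d = 4 := by
    rw [supConst, hτ, ← hM, one_div, inv_pow]
    field_simp
  calc polyFun p x ^ 2 * volume.real K ≤ S ^ 2 * volume.real K :=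
        mul_le_mul_of_nonneg_right h2 measureReal_nonneg
    _ = supConst d k * ((S / 2) ^ 2 * volume.real H) := by
        rw [hvolH]
        linear_combination (-(S ^ 2 / 4) * volume.real K) * hc
    _ ≤ _ := mul_le_mul_of_nonneg_left h1 (supConst_pos d k).le

/-- The oscillation of a polynomial on a compact convex set is bounded by the `L²` norm of its
gradient. -/
lemma sub_sq_mul_volume_le {d k : ℕ} {p : MvPolynomial (Fin d) ℝ} (hp : p.totalDegree ≤ k)
    {K : Set (Pt d)} (hK : Convex ℝ K) (hKc : IsCompact K) {x y : Pt d} (hx : x ∈ K)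
    (hy : y ∈ K) :
    (polyFun p y - polyFun p x) ^ 2 * volume.real K ≤
      supConst d k * ‖y - x‖ ^ 2 * ∫ z in K, ‖polyGrad p z‖ ^ 2 := by
  obtain ⟨q, -, h1, h2⟩ := exists_polynomial_on_line hp x (y - x)
  obtain ⟨t, ht, hmv⟩ := exists_hasDerivAt_eq_slope (fun t => q.eval t)
    (fun t => q.derivative.eval t) zero_lt_one q.continuous.continuousOn
    (fun t _ => q.hasDerivAt t)
  have e0 := h1 0
  have e1 := h1 1
  rw [zero_smul, add_zero] at e0
  rw [one_smul, add_sub_cancel] at e1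
  simp only [← e0, ← e1, ← h2, sub_zero, div_one] at hmv
  rw [← hmv]
  refine (sq_mul_volume_le (totalDegree_dirDeriv_le hp _) hK hKc
    (hK.add_smul_sub_mem hx hy ⟨ht.1.le, ht.2.le⟩)).trans ?_
  rw [mul_assoc, ← integral_const_mul (‖y - x‖ ^ 2)]
  refine mul_le_mul_of_nonneg_left ?_ (supConst_pos d k).le
  refine setIntegral_mono_on
    (((continuous_polyFun _).pow 2).continuousOn.integrableOn_compact hKc)
    ((((continuous_polyGrad p).norm.pow 2).const_mul _).continuousOn.integrableOn_compact hKc)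
    hKc.measurableSet fun z _ => ?_
  rw [← inner_polyGrad, ← mul_pow, ← sq_abs]
  refine pow_le_pow_left₀ (abs_nonneg _) ?_ 2
  rw [mul_comm]
  exact abs_real_inner_le_norm _ _

/-! ### Barycentric coordinates -/

/-- The `d + 1` points of `s` are the vertices of a nondegenerate simplex. -/
structure IsSimplex {d : ℕ} (s : Finset (Pt d)) : Prop where
  card_eq : s.card = d + 1
  affineIndependent : AffineIndependent ℝ (fun p : s => (p : Pt d))

lemma SimplicialMesh.isSimplex {d : ℕ} {Ω : Set (Pt d)} (T : SimplicialMesh Ω)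
    {s : Finset (Pt d)} (hs : s ∈ T.cells) : IsSimplex s :=
  ⟨T.card_eq s hs, T.affineIndependent s hs⟩

/-- The vertices of a nondegenerate simplex form an affine basis. -/
def IsSimplex.basis {d : ℕ} {s : Finset (Pt d)} (h : IsSimplex s) : AffineBasis s ℝ (Pt d) where
  toFun := fun p => (p : Pt d)
  ind' := h.affineIndependent
  tot' := by
    rw [h.affineIndependent.affineSpan_eq_top_iff_card_eq_finrank_add_one]
    simp [h.card_eq]

open Classical in
/-- The barycentric coordinate of the simplex `s` that belongs to the vertex `a`. By convention it
is `0` if `s` is not a nondegenerate simplex or `a` is not one of its vertices. -/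
def bary {d : ℕ} (s : Finset (Pt d)) (a : Pt d) : Pt d →ᵃ[ℝ] ℝ :=
  if h : IsSimplex s ∧ a ∈ s then h.1.basis.coord ⟨a, h.2⟩ else 0

namespace IsSimplex

variable {d : ℕ} {s t : Finset (Pt d)}

lemma bary_eq (h : IsSimplex s) (a : s) : bary s a = h.basis.coord a := by
  rw [bary, dif_pos ⟨h, a.2⟩]

lemma range_basis (h : IsSimplex s) : Set.range h.basis = (s : Set (Pt d)) :=
  Subtype.range_coe

lemma sum_bary (h : IsSimplex s) (x : Pt d) : ∑ a ∈ s, bary s a x = 1 := by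
  rw [← Finset.sum_coe_sort, ← h.basis.sum_coord_apply_eq_one x]
  exact Finset.sum_congr rfl fun a _ => by rw [h.bary_eq]

lemma sum_bary_smul (h : IsSimplex s) (x : Pt d) : ∑ a ∈ s, bary s a x • a = x := by
  rw [← Finset.sum_coe_sort]
  conv_rhs => rw [← h.basis.linear_combination_coord_eq_self x]
  exact Finset.sum_congr rfl fun a _ => by rw [h.bary_eq]; rfl

lemma mem_cell_iff (h : IsSimplex s) {x : Pt d} : x ∈ cell s ↔ ∀ a ∈ s, 0 ≤ bary s a x := by
  rw [cell, ← h.range_basis, h.basis.convexHull_eq_nonneg_coord]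
  exact ⟨fun hx a ha => by rw [h.bary_eq ⟨a, ha⟩]; exact hx ⟨a, ha⟩,
    fun hx a => by rw [← h.bary_eq a]; exact hx a a.2⟩

lemma mem_interior_cell (h : IsSimplex s) {x : Pt d} (hx : x ∈ interior (cell s)) {a : Pt d}
    (ha : a ∈ s) : 0 < bary s a x := by
  rw [cell, ← h.range_basis, h.basis.interior_convexHull] at hx
  rw [h.bary_eq ⟨a, ha⟩]
  exact hx ⟨a, ha⟩

lemma bary_vertex (h : IsSimplex s) {a b : Pt d} (ha : a ∈ s) (hb : b ∈ s) :
    bary s a b = if a = b then 1 else 0 := by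
  have := h.basis.coord_apply ⟨a, ha⟩ ⟨b, hb⟩
  rw [h.bary_eq ⟨a, ha⟩]
  simp only [Subtype.mk.injEq] at this
  exact this

end IsSimplex

/-- An affine map commutes with affine combinations. -/
lemma affineMap_sum_smul {d : ℕ} (f : Pt d →ᵃ[ℝ] ℝ) (F : Finset (Pt d)) {w : Pt d → ℝ}
    (hw : ∑ b ∈ F, w b = 1) : f (∑ b ∈ F, w b • b) = ∑ b ∈ F, w b * f b := by
  have hdec : ∀ y, f y = f.linear y + f 0 := fun y => congrFun f.decomp y
  rw [hdec]
  have h : ∀ b ∈ F, w b * f b = f.linear (w b • b) + w b * f 0 := fun b _ => by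
    rw [hdec b, map_smul, smul_eq_mul, mul_add]
  rw [Finset.sum_congr rfl h, Finset.sum_add_distrib, ← Finset.sum_mul, hw, one_mul, map_sum]

namespace IsSimplex

variable {d : ℕ} {s t : Finset (Pt d)}

lemma bary_sum_smul (h : IsSimplex s) {F : Finset (Pt d)} (hF : F ⊆ s) {w : Pt d → ℝ}
    (hw : ∑ b ∈ F, w b = 1) {a : Pt d} (ha : a ∈ s) :
    bary s a (∑ b ∈ F, w b • b) = if a ∈ F then w a else 0 := by
  rw [affineMap_sum_smul _ _ hw]
  rw [Finset.sum_congr rfl fun b hb => by rw [h.bary_vertex ha (hF hb)]]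
  simp

end IsSimplex

lemma isCompact_cell {d : ℕ} (s : Finset (Pt d)) : IsCompact (cell s) :=
  s.finite_toSet.isCompact_convexHull ℝ

lemma convex_cell {d : ℕ} (s : Finset (Pt d)) : Convex ℝ (cell s) := convex_convexHull ℝ _

lemma IsSimplex.cell_nonempty {d : ℕ} {s : Finset (Pt d)} (h : IsSimplex s) :
    (cell s).Nonempty := by
  have : s.Nonempty := Finset.card_pos.1 (by rw [h.card_eq]; omega)
  exact (Finset.coe_nonempty.2 this).convexHull

/-! ### Geometry of simplicial meshes -/

namespace SimplicialMesh

variable {d : ℕ} {Ω : Set (Pt d)} (T : SimplicialMesh Ω)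

lemma cell_subset {s : Finset (Pt d)} (hs : s ∈ T.cells) : cell s ⊆ closure Ω := by
  rw [← T.iUnion_eq]
  exact Set.subset_biUnion_of_mem (u := fun s : Finset (Pt d) => convexHull ℝ (s : Set (Pt d))) hs

lemma exists_mem_cell {x : Pt d} (hx : x ∈ closure Ω) : ∃ s ∈ T.cells, x ∈ cell s := by
  rw [← T.iUnion_eq] at hx
  simpa [cell] using hx

/-- On the intersection of two cells the barycentric coordinates that belong to common vertices
agree and the others vanish. -/
lemma bary_eq_of_mem {s t : Finset (Pt d)} (hs : s ∈ T.cells) (ht : t ∈ T.cells) {x : Pt d}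
    (hxs : x ∈ cell s) (hxt : x ∈ cell t) :
    (∀ a ∈ s, a ∈ t → bary s a x = bary t a x) ∧ ∀ a ∈ s, a ∉ t → bary s a x = 0 := by
  have hx : x ∈ convexHull ℝ ((s ∩ t : Finset (Pt d)) : Set (Pt d)) := by
    rw [Finset.coe_inter, ← T.matching s hs t ht]
    exact ⟨hxs, hxt⟩
  obtain ⟨w, -, hw, rfl⟩ := Finset.mem_convexHull'.1 hx
  have e1 := fun a (ha : a ∈ s) =>
    (T.isSimplex hs).bary_sum_smul Finset.inter_subset_left hw ha
  have e2 := fun a (ha : a ∈ t) =>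
    (T.isSimplex ht).bary_sum_smul Finset.inter_subset_right hw ha
  refine ⟨fun a has hat => by rw [e1 a has, e2 a hat], fun a has hat => ?_⟩
  rw [e1 a has, if_neg (by simp [hat])]

lemma volume_inter_eq_zero {s t : Finset (Pt d)} (hs : s ∈ T.cells) (ht : t ∈ T.cells)
    (hst : s ≠ t) : volume (cell s ∩ cell t) = 0 := by
  obtain ⟨a, has, hat⟩ : ∃ a ∈ s, a ∉ t := by
    by_contra! hcon
    exact hst (Finset.eq_of_subset_of_card_le hcon (by rw [T.card_eq s hs, T.card_eq t ht]))
  refine measure_mono_null (fun x hx => ?_) ((convex_cell s).addHaar_frontier volume)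
  refine ⟨subset_closure hx.1, fun hint => ?_⟩
  exact ((T.isSimplex hs).mem_interior_cell hint has).ne'
    ((T.bary_eq_of_mem hs ht hx.1 hx.2).2 a has hat)

lemma volume_frontier_eq_zero {d : ℕ} {Ω : Set (Pt d)} (T : SimplicialMesh Ω)
    (hΩ : IsPolyhedralDomain Ω) : volume (frontier Ω) = 0 := by
  have hsub : frontier Ω ⊆ ⋃ s ∈ T.cells, frontier (cell s) := by
    intro x hx
    obtain ⟨s, hs, hxs⟩ := T.exists_mem_cell hx.1
    refine Set.mem_biUnion hs ⟨subset_closure hxs, fun hint => hx.2 ?_⟩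
    rw [hΩ.isOpen.interior_eq, ← hΩ.interior_closure]
    exact interior_mono (T.cell_subset hs) hint
  refine measure_mono_null hsub ?_
  exact (measure_biUnion_null_iff T.cells.countable_toSet).2
    fun s _ => (convex_cell s).addHaar_frontier volume

/-- If `x` and `y` belong to the relative interior of the same face of the mesh, then the mesh looks
the same near both points, so both are interior points or none is. -/
lemma mem_of_bary_eq_zero_iff (hΩ : IsPolyhedralDomain Ω) {s : Finset (Pt d)} (hs : s ∈ T.cells)
    {x y : Pt d} (hx : x ∈ cell s) (hy : y ∈ cell s)
    (hxy : ∀ a ∈ s, bary s a x = 0 ↔ bary s a y = 0) (hyΩ : y ∈ Ω) : x ∈ Ω := by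
  have hface : ∀ t ∈ T.cells, y ∈ cell t →
      ∀ a ∈ t, (bary t a x = 0 ↔ bary t a y = 0) ∧ 0 ≤ bary t a x := by
    intro t ht hyt
    have hxt : x ∈ cell t := by
      have hsum : ∑ a ∈ s ∩ t, bary s a x • a = x := by
        conv_rhs => rw [← (T.isSimplex hs).sum_bary_smul x]
        refine Finset.sum_subset Finset.inter_subset_left fun a ha hat => ?_
        have h0 : bary s a y = 0 :=
          (T.bary_eq_of_mem hs ht hy hyt).2 a ha fun h => hat (Finset.mem_inter.2 ⟨ha, h⟩)
        rw [(hxy a ha).2 h0, zero_smul]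
      have hsum1 : ∑ a ∈ s ∩ t, bary s a x = 1 := by
        rw [← (T.isSimplex hs).sum_bary x]
        refine Finset.sum_subset Finset.inter_subset_left fun a ha hat => ?_
        have h0 : bary s a y = 0 :=
          (T.bary_eq_of_mem hs ht hy hyt).2 a ha fun h => hat (Finset.mem_inter.2 ⟨ha, h⟩)
        exact (hxy a ha).2 h0
      rw [← hsum]
      exact (convex_cell t).sum_mem
        (fun a ha => (T.isSimplex hs).mem_cell_iff.1 hx a (Finset.mem_inter.1 ha).1) hsum1
        fun a ha => subset_convexHull ℝ _ (Finset.mem_inter.1 ha).2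
    intro a ha
    refine ⟨?_, (T.isSimplex ht).mem_cell_iff.1 hxt a ha⟩
    by_cases has : a ∈ s
    · rw [(T.bary_eq_of_mem ht hs hxt hx).1 a ha has, (T.bary_eq_of_mem ht hs hyt hy).1 a ha has]
      exact hxy a has
    · rw [(T.bary_eq_of_mem ht hs hxt hx).2 a ha has, (T.bary_eq_of_mem ht hs hyt hy).2 a ha has]
  -- Translation by `x - y` maps the points of `closure Ω` near `y` to points of `closure Ω`.
  have hty : Filter.Tendsto (fun z : Pt d => z - x + y) (nhds x) (nhds y) := by
    have : Continuous fun z : Pt d => z - x + y := by fun_prop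
    simpa using this.tendsto x
  have h1 : ∀ᶠ z in nhds x, z - x + y ∈ Ω := hty.eventually (hΩ.isOpen.mem_nhds hyΩ)
  have h2 : ∀ᶠ z in nhds x, ∀ t ∈ T.cells, y ∉ cell t → z - x + y ∉ cell t := by
    rw [Filter.eventually_all_finset]
    intro t _
    rw [Filter.eventually_imp_distrib_left]
    exact fun hyt => hty.eventually ((isCompact_cell t).isClosed.isOpen_compl.mem_nhds hyt)
  have h3 : ∀ᶠ z in nhds x, ∀ t ∈ T.cells, ∀ a ∈ t, 0 < bary t a x → 0 < bary t a z := by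
    rw [Filter.eventually_all_finset]
    intro t _
    rw [Filter.eventually_all_finset]
    intro a _
    rw [Filter.eventually_imp_distrib_left]
    exact fun h0 => ((bary t a).continuous_of_finiteDimensional.tendsto x).eventually
      (lt_mem_nhds h0)
  rw [← hΩ.interior_closure, mem_interior_iff_mem_nhds]
  filter_upwards [h1, h2, h3] with z hz1 hz2 hz3
  obtain ⟨t, ht, hzt⟩ := T.exists_mem_cell (subset_closure hz1)
  have hyt : y ∈ cell t := by
    by_contra hcon
    exact hz2 t ht hcon hzt
  refine T.cell_subset ht ((T.isSimplex ht).mem_cell_iff.2 fun a ha => ?_)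
  obtain ⟨hiff, h0⟩ := hface t ht hyt a ha
  rcases h0.eq_or_lt with h0 | h0
  · have hdec : ∀ w, bary t a w = (bary t a).linear w + bary t a 0 :=
      fun w => congrFun (bary t a).decomp w
    have hzz := (T.isSimplex ht).mem_cell_iff.1 hzt a ha
    have e1 := hiff.1 h0.symm
    have e2 := h0
    rw [hdec, map_add, map_sub] at hzz
    rw [hdec] at e1 e2 ⊢
    linarith
  · exact (hz3 t ht a ha h0).le

/-- If `x` is a boundary point, then so is every point of the smallest face that contains `x`. -/
lemma mem_frontier_of_bary (hΩ : IsPolyhedralDomain Ω) {s : Finset (Pt d)} (hs : s ∈ T.cells)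
    {x y : Pt d} (hx : x ∈ cell s) (hy : y ∈ cell s)
    (hxy : ∀ a ∈ s, bary s a x = 0 → bary s a y = 0) (hxΩ : x ∈ frontier Ω) :
    y ∈ frontier Ω := by
  refine ⟨T.cell_subset hs hy, fun hyΩ => hxΩ.2 ?_⟩
  rw [hΩ.isOpen.interior_eq] at hyΩ ⊢
  -- Move `y` slightly towards `x`, into the relative interior of the smallest face.
  have hcont : Filter.Tendsto (fun ε : ℝ => y + ε • (x - y)) (nhdsWithin 0 (Set.Ioi 0))
      (nhds y) := by
    have : Continuous fun ε : ℝ => y + ε • (x - y) := by fun_prop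
    have h := this.tendsto 0
    simp only [zero_smul, add_zero] at h
    exact h.mono_left nhdsWithin_le_nhds
  obtain ⟨ε, hε, hεΩ⟩ := (Filter.Eventually.and (Ioo_mem_nhdsGT (zero_lt_one' ℝ))
    (hcont.eventually (hΩ.isOpen.mem_nhds hyΩ))).exists
  refine T.mem_of_bary_eq_zero_iff hΩ hs hx
    ((convex_cell s).add_smul_sub_mem hy hx ⟨hε.1.le, hε.2.le⟩) (fun a ha => ?_) hεΩ
  have hdec : ∀ w, bary s a w = (bary s a).linear w + bary s a 0 :=
    fun w => congrFun (bary s a).decomp w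
  have e : bary s a (y + ε • (x - y)) = (1 - ε) * bary s a y + ε * bary s a x := by
    rw [hdec, hdec y, hdec x, map_add, map_smul, map_sub, smul_eq_mul]
    ring
  have hx0 := (T.isSimplex hs).mem_cell_iff.1 hx a ha
  have hy0 := (T.isSimplex hs).mem_cell_iff.1 hy a ha
  rw [e]
  constructor
  · intro h
    rw [h, hxy a ha h]; ring
  · intro h
    have h1 := mul_nonneg (sub_nonneg.2 hε.2.le) hy0
    have h2 := mul_nonneg hε.1.le hx0
    have h3 : ε * bary s a x = 0 := by linarith
    exact (mul_eq_zero.1 h3).resolve_left hε.1.ne'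

end SimplicialMesh

/-! ### Cut-off in the Lagrange space -/

/-- An affine function as a polynomial. -/
def affPoly {d : ℕ} (f : Pt d →ᵃ[ℝ] ℝ) : MvPolynomial (Fin d) ℝ :=
  MvPolynomial.C (f 0) +
    ∑ i, MvPolynomial.C (f.linear (EuclideanSpace.single i 1)) * MvPolynomial.X i

lemma polyFun_affPoly {d : ℕ} (f : Pt d →ᵃ[ℝ] ℝ) (x : Pt d) : polyFun (affPoly f) x = f x := by
  have hdec : f x = f.linear x + f 0 := congrFun f.decomp x
  have hx : x = ∑ i, x i • EuclideanSpace.single i (1 : ℝ) := by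
    ext j
    simp [Pi.single_apply]
  rw [hdec]
  conv_rhs => rw [hx]
  simp only [polyFun, affPoly, map_add, map_sum, map_mul, MvPolynomial.eval_C,
    MvPolynomial.eval_X, map_smul, smul_eq_mul]
  rw [add_comm]
  congr 1
  exact Finset.sum_congr rfl fun i _ => mul_comm _ _

lemma totalDegree_affPoly_le {d : ℕ} (f : Pt d →ᵃ[ℝ] ℝ) : (affPoly f).totalDegree ≤ 1 := by
  refine (MvPolynomial.totalDegree_add _ _).trans (max_le (by simp) ?_)
  refine MvPolynomial.totalDegree_finsetSum_le fun i _ => ?_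
  refine (MvPolynomial.totalDegree_mul _ _).trans ?_
  simp

/-- The homogenization `m ^ k * p (M / m)` of a polynomial of degree at most `k` at polynomials `M`
and `m` of degree at most `1` is a polynomial of degree at most `k`. -/
lemma exists_homogenization {d k : ℕ} {p : MvPolynomial (Fin d) ℝ}
    (hp : p.totalDegree ≤ k) (M : Fin d → MvPolynomial (Fin d) ℝ)
    (m : MvPolynomial (Fin d) ℝ) (hM : ∀ i, (M i).totalDegree ≤ 1) (hm : m.totalDegree ≤ 1) :
    ∃ q : MvPolynomial (Fin d) ℝ, q.totalDegree ≤ k ∧ ∀ x y : Pt d,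
      (∀ i, polyFun (M i) x = polyFun m x * y i) →
        polyFun q x = polyFun m x ^ k * polyFun p y := by
  refine ⟨∑ e ∈ p.support, MvPolynomial.C (p.coeff e) * ((∏ i, M i ^ e i) *
    m ^ (k - ∑ i, e i)), ?_, ?_⟩
  · refine MvPolynomial.totalDegree_finsetSum_le fun e he => ?_
    have hek : ∑ i, e i ≤ k := by
      refine le_trans ?_ ((MvPolynomial.le_totalDegree he).trans hp)
      rw [Finsupp.sum_fintype _ _ fun _ => rfl]
    refine (MvPolynomial.totalDegree_mul _ _).trans ?_
    rw [MvPolynomial.totalDegree_C, zero_add]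
    refine (MvPolynomial.totalDegree_mul _ _).trans ?_
    have h1 : (∏ i, M i ^ e i).totalDegree ≤ ∑ i, e i := by
      refine (MvPolynomial.totalDegree_finsetProd _ _).trans (Finset.sum_le_sum fun i _ => ?_)
      refine (MvPolynomial.totalDegree_pow _ _).trans ?_
      exact (Nat.mul_le_mul_left _ (hM i)).trans_eq (mul_one _)
    have h2 : (m ^ (k - ∑ i, e i)).totalDegree ≤ k - ∑ i, e i := by
      refine (MvPolynomial.totalDegree_pow _ _).trans ?_
      exact (Nat.mul_le_mul_left _ hm).trans_eq (mul_one _)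
    omega
  · intro x y hxy
    have hsum : polyFun p y = ∑ e ∈ p.support, p.coeff e * ∏ i, y i ^ e i := by
      rw [polyFun, MvPolynomial.eval_eq']
    rw [hsum, Finset.mul_sum]
    unfold polyFun
    rw [map_sum]
    refine Finset.sum_congr rfl fun e he => ?_
    have hek : ∑ i, e i ≤ k := by
      refine le_trans ?_ ((MvPolynomial.le_totalDegree he).trans hp)
      rw [Finsupp.sum_fintype _ _ fun _ => rfl]
    rw [map_mul, map_mul, map_prod, MvPolynomial.eval_C, map_pow]
    have h1 : ∏ i, MvPolynomial.eval (fun i => x i) (M i ^ e i) =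
        polyFun m x ^ (∑ i, e i) * ∏ i, y i ^ e i := by
      rw [← Finset.prod_pow_eq_pow_sum, ← Finset.prod_mul_distrib]
      refine Finset.prod_congr rfl fun i _ => ?_
      rw [map_pow, ← mul_pow, ← hxy i, polyFun]
    rw [h1]
    have h2 : polyFun m x ^ k = polyFun m x ^ (∑ i, e i) * polyFun m x ^ (k - ∑ i, e i) := by
      rw [← pow_add, Nat.add_sub_cancel' hek]
    unfold polyFun at h2 ⊢
    rw [h2]
    ring

/-- The sum of the barycentric coordinates of the simplex `s` that belong to vertices in `V`. -/
def faceWeight {d : ℕ} (V s : Finset (Pt d)) (x : Pt d) : ℝ := ∑ a ∈ s ∩ V, bary s a x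

/-- The combination of the vertices of `s` in `V` with the barycentric coordinates as weights. -/
def faceMoment {d : ℕ} (V s : Finset (Pt d)) (x : Pt d) : Pt d := ∑ a ∈ s ∩ V, bary s a x • a

/-- The projection of a point of the simplex `s` to the face spanned by the vertices in `V`, along
the joining line to the opposite face. Defined where `faceWeight` does not vanish. -/
def faceProj {d : ℕ} (V s : Finset (Pt d)) (x : Pt d) : Pt d :=
  (faceWeight V s x)⁻¹ • faceMoment V s x

/-- The cut-off of `u - c` on the simplex `s`. If `u` is a polynomial of degree at most `k`, then so
is the cut-off: in terms of the homogeneous polynomial of degree `k` in the barycentric coordinates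
that represents `u - c`, the coordinates of vertices outside `V` are set to zero. -/
def cutCell {d : ℕ} (k : ℕ) (u : Pt d → ℝ) (V s : Finset (Pt d)) (c : ℝ) (x : Pt d) : ℝ :=
  faceWeight V s x ^ k * (u (faceProj V s x) - c)

namespace IsSimplex

variable {d : ℕ} {s V : Finset (Pt d)}

lemma faceWeight_nonneg (h : IsSimplex s) {x : Pt d} (hx : x ∈ cell s) :
    0 ≤ faceWeight V s x :=
  Finset.sum_nonneg fun a ha => h.mem_cell_iff.1 hx a (Finset.mem_inter.1 ha).1

lemma faceWeight_le_one (h : IsSimplex s) {x : Pt d} (hx : x ∈ cell s) :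
    faceWeight V s x ≤ 1 := by
  rw [← h.sum_bary x]
  exact Finset.sum_le_sum_of_subset_of_nonneg Finset.inter_subset_left
    fun a ha _ => h.mem_cell_iff.1 hx a ha

lemma faceProj_eq (x : Pt d) :
    faceProj V s x = ∑ a ∈ s ∩ V, ((faceWeight V s x)⁻¹ * bary s a x) • a := by
  rw [faceProj, faceMoment, Finset.smul_sum]
  exact Finset.sum_congr rfl fun a _ => smul_smul _ _ _

lemma sum_faceProj_weights {x : Pt d} (hx : faceWeight V s x ≠ 0) :
    ∑ a ∈ s ∩ V, (faceWeight V s x)⁻¹ * bary s a x = 1 := by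
  rw [← Finset.mul_sum]
  exact inv_mul_cancel₀ hx

lemma faceProj_mem (h : IsSimplex s) {x : Pt d} (hx : x ∈ cell s)
    (h0 : faceWeight V s x ≠ 0) : faceProj V s x ∈ cell s := by
  rw [faceProj_eq]
  exact (convex_cell s).sum_mem
    (fun a ha => mul_nonneg (inv_nonneg.2 (h.faceWeight_nonneg hx))
      (h.mem_cell_iff.1 hx a (Finset.mem_inter.1 ha).1))
    (sum_faceProj_weights h0) fun a ha => subset_convexHull ℝ _ (Finset.mem_inter.1 ha).1

lemma bary_faceProj_eq_zero (h : IsSimplex s) {x : Pt d} (h0 : faceWeight V s x ≠ 0)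
    {a : Pt d} (ha : a ∈ s) (hax : bary s a x = 0) : bary s a (faceProj V s x) = 0 := by
  rw [faceProj_eq, h.bary_sum_smul Finset.inter_subset_left (sum_faceProj_weights h0) ha]
  simp [hax]

lemma faceMoment_eq_zero (h : IsSimplex s) {x : Pt d} (hx : x ∈ cell s)
    (h0 : faceWeight V s x = 0) : faceMoment V s x = 0 := by
  have := (Finset.sum_eq_zero_iff_of_nonneg
    fun a ha => h.mem_cell_iff.1 hx a (Finset.mem_inter.1 ha).1).1 h0
  exact Finset.sum_eq_zero fun a ha => by rw [this a ha, zero_smul]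

lemma cutCell_of_subset (h : IsSimplex s) (hsV : s ⊆ V) (k : ℕ) (u : Pt d → ℝ) (c : ℝ)
    (x : Pt d) : cutCell k u V s c x = u x - c := by
  have h1 : faceWeight V s x = 1 := by
    rw [faceWeight, Finset.inter_eq_left.2 hsV, h.sum_bary]
  have h2 : faceMoment V s x = x := by
    rw [faceMoment, Finset.inter_eq_left.2 hsV, h.sum_bary_smul]
  rw [cutCell, faceProj, h1, h2, one_pow, one_mul, inv_one, one_smul]

lemma abs_cutCell_le (h : IsSimplex s) {k : ℕ} {u : Pt d → ℝ} {c S : ℝ} (hk : 1 ≤ k)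
    (hS : ∀ x ∈ cell s, |u x - c| ≤ S) {x : Pt d} (hx : x ∈ cell s) :
    |cutCell k u V s c x| ≤ S := by
  have hS0 : 0 ≤ S := (abs_nonneg _).trans (hS x hx)
  rw [cutCell]
  by_cases h0 : faceWeight V s x = 0
  · rwa [h0, zero_pow (by omega), zero_mul, abs_zero]
  · rw [abs_mul, abs_of_nonneg (pow_nonneg (h.faceWeight_nonneg hx) k)]
    exact (mul_le_of_le_one_left (abs_nonneg _)
      (pow_le_one₀ (h.faceWeight_nonneg hx) (h.faceWeight_le_one hx))).trans
      (hS _ (h.faceProj_mem hx h0))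

lemma exists_polyFun_eq_cutCell (h : IsSimplex s) {k : ℕ} {u : Pt d → ℝ} (c : ℝ) (hk : 1 ≤ k)
    {p : MvPolynomial (Fin d) ℝ} (hp : p.totalDegree ≤ k) (hu : ∀ x ∈ cell s, u x = polyFun p x) :
    ∃ q : MvPolynomial (Fin d) ℝ, q.totalDegree ≤ k ∧
      ∀ x ∈ cell s, cutCell k u V s c x = polyFun q x := by
  set m : MvPolynomial (Fin d) ℝ := ∑ a ∈ s ∩ V, affPoly (bary s a) with hm
  set M : Fin d → MvPolynomial (Fin d) ℝ :=
    fun i => ∑ a ∈ s ∩ V, affPoly (bary s a) * MvPolynomial.C (a i) with hM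
  have hme : ∀ x, polyFun m x = faceWeight V s x := by
    intro x
    have : polyFun m x = ∑ a ∈ s ∩ V, polyFun (affPoly (bary s a)) x := by
      simp [polyFun, hm]
    rw [this, faceWeight]
    exact Finset.sum_congr rfl fun a _ => polyFun_affPoly _ _
  have hMe : ∀ x i, polyFun (M i) x = faceMoment V s x i := by
    intro x i
    have : polyFun (M i) x = ∑ a ∈ s ∩ V, polyFun (affPoly (bary s a)) x * a i := by
      simp [polyFun, hM]
    rw [this, faceMoment, WithLp.ofLp_sum, Finset.sum_apply]
    refine Finset.sum_congr rfl fun a _ => ?_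
    rw [polyFun_affPoly]
    rfl
  have hmd : m.totalDegree ≤ 1 :=
    MvPolynomial.totalDegree_finsetSum_le fun a _ => totalDegree_affPoly_le _
  have hMd : ∀ i, (M i).totalDegree ≤ 1 := fun i =>
    MvPolynomial.totalDegree_finsetSum_le fun a _ =>
      (MvPolynomial.totalDegree_mul _ _).trans (by
        rw [MvPolynomial.totalDegree_C, add_zero]
        exact totalDegree_affPoly_le _)
  have hpc : (p - MvPolynomial.C c).totalDegree ≤ k :=
    (MvPolynomial.totalDegree_sub _ _).trans (max_le hp (by simp))
  obtain ⟨q, hq, hqe⟩ := exists_homogenization hpc M m hMd hmd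
  refine ⟨q, hq, fun x hx => ?_⟩
  by_cases h0 : faceWeight V s x = 0
  · rw [hqe x 0 fun i => by rw [hMe, h.faceMoment_eq_zero hx h0]; simp, hme, cutCell, h0,
      zero_pow (by omega), zero_mul, zero_mul]
  · rw [hqe x (faceProj V s x) fun i => ?_, hme, cutCell, hu _ (h.faceProj_mem hx h0)]
    · simp [polyFun]
    · rw [hMe, hme, faceProj, PiLp.smul_apply, smul_eq_mul, mul_inv_cancel_left₀ h0]

end IsSimplex

namespace SimplicialMesh

variable {d : ℕ} {Ω : Set (Pt d)} (T : SimplicialMesh Ω)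

lemma faceWeight_eq_and_faceMoment_eq {s t : Finset (Pt d)} (V : Finset (Pt d)) (hs : s ∈ T.cells)
    (ht : t ∈ T.cells) {x : Pt d} (hxs : x ∈ cell s) (hxt : x ∈ cell t) :
    faceWeight V s x = faceWeight V t x ∧ faceMoment V s x = faceMoment V t x := by
  have hst := T.bary_eq_of_mem hs ht hxs hxt
  have hts := T.bary_eq_of_mem ht hs hxt hxs
  have e1 : faceWeight V s x = ∑ a ∈ s ∩ t ∩ V, bary s a x := by
    unfold faceWeight
    symm
    convert Finset.sum_subset (s₁ := s ∩ t ∩ V) (s₂ := s ∩ V) (f := fun a => bary s a x) ?_ ?_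
    · grind
    · intro a ha hna
      simp only [Finset.mem_inter] at ha hna
      exact hst.2 a ha.1 fun h => hna ⟨⟨ha.1, h⟩, ha.2⟩
  have e2 : faceWeight V t x = ∑ a ∈ s ∩ t ∩ V, bary t a x := by
    unfold faceWeight
    symm
    convert Finset.sum_subset (s₁ := s ∩ t ∩ V) (s₂ := t ∩ V) (f := fun a => bary t a x) ?_ ?_
    · grind
    · intro a ha hna
      simp only [Finset.mem_inter] at ha hna
      exact hts.2 a ha.1 fun h => hna ⟨⟨h, ha.1⟩, ha.2⟩
  have e3 : faceMoment V s x = ∑ a ∈ s ∩ t ∩ V, bary s a x • a := by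
    unfold faceMoment
    symm
    convert Finset.sum_subset (s₁ := s ∩ t ∩ V) (s₂ := s ∩ V) (f := fun a => bary s a x • a) ?_ ?_
    · grind
    · intro a ha hna
      simp only [Finset.mem_inter] at ha hna
      rw [hst.2 a ha.1 fun h => hna ⟨⟨ha.1, h⟩, ha.2⟩, zero_smul]
  have e4 : faceMoment V t x = ∑ a ∈ s ∩ t ∩ V, bary t a x • a := by
    unfold faceMoment
    symm
    convert Finset.sum_subset (s₁ := s ∩ t ∩ V) (s₂ := t ∩ V) (f := fun a => bary t a x • a) ?_ ?_
    · grind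
    · intro a ha hna
      simp only [Finset.mem_inter] at ha hna
      rw [hts.2 a ha.1 fun h => hna ⟨⟨h, ha.1⟩, ha.2⟩, zero_smul]
  rw [e1, e2, e3, e4]
  constructor
  all_goals
    refine Finset.sum_congr rfl fun a ha => ?_
    simp only [Finset.mem_inter] at ha
    rw [hst.1 a ha.1.1 ha.1.2]

/-- Cut-off within the Lagrange space: keep `u - c` on the cells all of whose vertices are in `V`,
and replace it by zero on the cells without vertices in `V`. The constants `c` may change from cell
to cell, but not between touching cells with vertices in `V`. -/
theorem exists_cutoff (hΩ : IsPolyhedralDomain Ω) {k : ℕ} (hk : 1 ≤ k) {u : Pt d → ℝ}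
    (hu : u ∈ T.Pk k) (V : Finset (Pt d)) (c : Finset (Pt d) → ℝ)
    (hc : ∀ s ∈ T.cells, ∀ t ∈ T.cells, ¬Disjoint s V → ¬Disjoint t V →
      (cell s ∩ cell t).Nonempty → c s = c t)
    (hbd : ∀ s ∈ T.cells, ¬Disjoint s V → ∀ x ∈ cell s, x ∈ frontier Ω → u x = 0 ∧ c s = 0) :
    ∃ v ∈ T.PkZero k, (∀ s ∈ T.cells, s ⊆ V → ∀ x ∈ cell s, v x = u x - c s) ∧
      (∀ s ∈ T.cells, Disjoint s V → ∀ x ∈ cell s, v x = 0) ∧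
      ∀ s ∈ T.cells, ∀ S, (∀ x ∈ cell s, |u x - c s| ≤ S) → ∀ x ∈ cell s, |v x| ≤ S := by
  classical
  have hzero : ∀ s, Disjoint s V → ∀ x, cutCell k u V s (c s) x = 0 := by
    intro s hs x
    rw [cutCell, faceWeight, Finset.disjoint_iff_inter_eq_empty.1 hs, Finset.sum_empty,
      zero_pow (by omega), zero_mul]
  have hagree : ∀ s ∈ T.cells, ∀ t ∈ T.cells, ∀ x, x ∈ cell s → x ∈ cell t →
      cutCell k u V s (c s) x = cutCell k u V t (c t) x := by
    intro s hs t ht x hxs hxt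
    obtain ⟨hw, hm⟩ := T.faceWeight_eq_and_faceMoment_eq V hs ht hxs hxt
    by_cases h0 : faceWeight V s x = 0
    · rw [cutCell, cutCell, ← hw, h0, zero_pow (by omega), zero_mul, zero_mul]
    · have hsV : ¬Disjoint s V := fun h => h0 (by
        rw [faceWeight, Finset.disjoint_iff_inter_eq_empty.1 h, Finset.sum_empty])
      have htV : ¬Disjoint t V := fun h => h0 (by
        rw [hw, faceWeight, Finset.disjoint_iff_inter_eq_empty.1 h, Finset.sum_empty])
      rw [cutCell, cutCell, faceProj, faceProj, hw, hm, hc s hs t ht hsV htV ⟨x, hxs, hxt⟩]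
  set v : Pt d → ℝ := fun x =>
    if h : ∃ s ∈ T.cells, x ∈ cell s then cutCell k u V h.choose (c h.choose) x else 0 with hv
  have hve : ∀ s ∈ T.cells, ∀ x ∈ cell s, v x = cutCell k u V s (c s) x := by
    intro s hs x hx
    have h : ∃ s ∈ T.cells, x ∈ cell s := ⟨s, hs, hx⟩
    simp only [hv]
    rw [dif_pos h]
    exact hagree _ h.choose_spec.1 s hs x h.choose_spec.2 hx
  have hpoly : ∀ s ∈ T.cells, ∃ q : MvPolynomial (Fin d) ℝ, q.totalDegree ≤ k ∧
      ∀ x ∈ cell s, v x = polyFun q x := by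
    intro s hs
    obtain ⟨p, hp, hup⟩ := hu.2 s hs
    obtain ⟨q, hq, hqe⟩ :=
      (T.isSimplex hs).exists_polyFun_eq_cutCell (V := V) (c s) hk hp hup
    exact ⟨q, hq, fun x hx => by rw [hve s hs x hx, hqe x hx]⟩
  refine ⟨v, ⟨⟨?_, hpoly⟩, ?_⟩, ?_, ?_, ?_⟩
  · have hU : closure Ω = ⋃ s : T.cells, cell (s : Finset (Pt d)) := by
      rw [← T.iUnion_eq]
      exact (Set.iUnion_subtype (· ∈ T.cells) fun s => cell (s : Finset (Pt d))).symm
    rw [hU]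
    refine (locallyFinite_of_finite _).continuousOn_iUnion
      (fun s => (isCompact_cell _).isClosed) fun s => ?_
    obtain ⟨q, -, hq⟩ := hpoly s s.2
    exact (continuous_polyFun q).continuousOn.congr hq
  · intro x hx
    obtain ⟨s, hs, hxs⟩ := T.exists_mem_cell hx.1
    rw [hve s hs x hxs]
    by_cases hsV : Disjoint s V
    · exact hzero s hsV x
    by_cases h0 : faceWeight V s x = 0
    · rw [cutCell, h0, zero_pow (by omega), zero_mul]
    · have hmem := (T.isSimplex hs).faceProj_mem hxs h0
      have hfr := T.mem_frontier_of_bary hΩ hs hxs hmem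
        (fun a ha => (T.isSimplex hs).bary_faceProj_eq_zero h0 ha) hx
      obtain ⟨h1, h2⟩ := hbd s hs hsV _ hmem hfr
      rw [cutCell, h1, h2, sub_zero, mul_zero]
  · intro s hs hsV x hx
    rw [hve s hs x hx, (T.isSimplex hs).cutCell_of_subset hsV]
  · intro s hs hsV x hx
    rw [hve s hs x hx, hzero s hsV]
  · intro s hs S hS x hx
    rw [hve s hs x hx]
    exact (T.isSimplex hs).abs_cutCell_le hk hS hx

end SimplicialMesh

/-! ### Energy forms on cells -/

/-- The bilinear form of the discrete problem, restricted to `S`. -/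
def bForm {d : ℕ} (A : Pt d → Matrix (Fin d) (Fin d) ℝ) (lam : ℝ) (S : Set (Pt d))
    (u v : Pt d → ℝ) : ℝ :=
  aForm A S u v + lam ^ 2 * l2Form S u v

lemma energyNormSq_eq_bForm {d : ℕ} (A : Pt d → Matrix (Fin d) (Fin d) ℝ) (lam : ℝ)
    (S : Set (Pt d)) (u : Pt d → ℝ) : energyNormSq A lam S u = bForm A lam S u u := rfl

/-- The square of a weighted `H¹` norm that controls the bilinear form. -/
def h1NormSq {d : ℕ} (β lam : ℝ) (S : Set (Pt d)) (u : Pt d → ℝ) : ℝ :=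
  β * (∫ x in S, ‖gradient u x‖ ^ 2) + lam ^ 2 * ∫ x in S, u x ^ 2

lemma ae_cell_mem_interior {d : ℕ} (s : Finset (Pt d)) :
    ∀ᵐ x ∂(volume.restrict (cell s)), x ∈ interior (cell s) := by
  rw [ae_restrict_iff' (isCompact_cell s).measurableSet]
  have h := (convex_cell s).addHaar_frontier volume
  filter_upwards [measure_eq_zero_iff_ae_notMem.1 h] with x hx hxs
  by_contra hcon
  exact hx ⟨subset_closure hxs, hcon⟩

/-- A function that is a polynomial on a cell has the gradient of this polynomial almost everywhere
in the cell. -/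
lemma ae_gradient_eq {d : ℕ} {s : Finset (Pt d)} {u : Pt d → ℝ} {p : MvPolynomial (Fin d) ℝ}
    (hu : ∀ x ∈ cell s, u x = polyFun p x) :
    ∀ᵐ x ∂(volume.restrict (cell s)), gradient u x = polyGrad p x := by
  filter_upwards [ae_cell_mem_interior s] with x hx
  have heq : u =ᶠ[nhds x] polyFun p := by
    filter_upwards [mem_interior_iff_mem_nhds.1 hx] with y hy using hu y hy
  exact ((hasGradientAt_polyFun p x).congr_of_eventuallyEq heq).gradient

lemma ae_cell_eq {d : ℕ} {s : Finset (Pt d)} {u : Pt d → ℝ} {p : MvPolynomial (Fin d) ℝ}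
    (hu : ∀ x ∈ cell s, u x = polyFun p x) :
    ∀ᵐ x ∂(volume.restrict (cell s)), u x = polyFun p x :=
  (ae_restrict_mem (isCompact_cell s).measurableSet).mono hu

lemma IsCoefficient.mono {d : ℕ} {S S' : Set (Pt d)} {α β : ℝ}
    {A : Pt d → Matrix (Fin d) (Fin d) ℝ} (hA : IsCoefficient S α β A)
    (h : volume.restrict S' ≤ volume.restrict S) : IsCoefficient S' α β A where
  aemeasurable i j := (hA.aemeasurable i j).mono_measure h
  lower := ae_mono h hA.lower
  upper := ae_mono h hA.upper

lemma SimplicialMesh.isCoefficient_cell {d : ℕ} {Ω : Set (Pt d)} (T : SimplicialMesh Ω)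
    (hΩ : IsPolyhedralDomain Ω) {s : Finset (Pt d)} (hs : s ∈ T.cells) {α β : ℝ}
    {A : Pt d → Matrix (Fin d) (Fin d) ℝ} (hA : IsCoefficient Ω α β A) :
    IsCoefficient (cell s) α β A := by
  refine hA.mono ((Measure.restrict_mono_set volume (T.cell_subset hs)).trans_eq ?_)
  refine Measure.restrict_congr_set ?_
  rw [closure_eq_self_union_frontier]
  exact union_ae_eq_left_of_ae_eq_empty (ae_eq_empty.2 (T.volume_frontier_eq_zero hΩ))

section Cell

variable {d : ℕ} {s : Finset (Pt d)} {α β lam : ℝ} {A : Pt d → Matrix (Fin d) (Fin d) ℝ}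
  {u v : Pt d → ℝ}

/-- The restriction to the cell `s` is a polynomial. -/
def IsPolyOn (s : Finset (Pt d)) (u : Pt d → ℝ) : Prop :=
  ∃ p : MvPolynomial (Fin d) ℝ, ∀ x ∈ cell s, u x = polyFun p x

lemma IsPolyOn.integrableOn_mul (hu : IsPolyOn s u) (hv : IsPolyOn s v) :
    IntegrableOn (fun x => u x * v x) (cell s) := by
  obtain ⟨p, hp⟩ := hu
  obtain ⟨q, hq⟩ := hv
  have h : IntegrableOn (fun x => polyFun p x * polyFun q x) (cell s) :=
    ((continuous_polyFun p).mul (continuous_polyFun q)).continuousOn.integrableOn_compact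
      (isCompact_cell s)
  refine h.congr ?_
  filter_upwards [ae_cell_eq hp, ae_cell_eq hq] with x hx hy
  rw [hx, hy]

lemma IsPolyOn.integrableOn_gradient_sq (hu : IsPolyOn s u) :
    IntegrableOn (fun x => ‖gradient u x‖ ^ 2) (cell s) := by
  obtain ⟨p, hp⟩ := hu
  have h : IntegrableOn (fun x => ‖polyGrad p x‖ ^ 2) (cell s) :=
    ((continuous_polyGrad p).norm.pow 2).continuousOn.integrableOn_compact (isCompact_cell s)
  refine h.congr ?_
  filter_upwards [ae_gradient_eq hp] with x hx
  rw [hx]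

lemma IsPolyOn.integrableOn_aForm (hA : IsCoefficient (cell s) α β A) (hu : IsPolyOn s u)
    (hv : IsPolyOn s v) :
    IntegrableOn (fun x => inner ℝ (Matrix.toEuclideanLin (A x) (gradient u x)) (gradient v x))
      (cell s) := by
  obtain ⟨p, hp⟩ := hu
  obtain ⟨q, hq⟩ := hv
  have hdom : IntegrableOn (fun x => β * ‖polyGrad p x‖ * ‖polyGrad q x‖) (cell s) :=
    ((continuous_const.mul (continuous_polyGrad p).norm).mul
      (continuous_polyGrad q).norm).continuousOn.integrableOn_compact (isCompact_cell s)
  have h : IntegrableOn (fun x => inner ℝ (Matrix.toEuclideanLin (A x) (polyGrad p x))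
      (polyGrad q x)) (cell s) := by
    refine Integrable.mono' hdom ?_ ?_
    · have hexp : (fun x => inner ℝ (Matrix.toEuclideanLin (A x) (polyGrad p x))
          (polyGrad q x)) = fun x => ∑ i, polyGrad q x i * ∑ j, A x i j * polyGrad p x j := by
        ext x
        simp [PiLp.inner_apply, Matrix.toLpLin_apply, Matrix.mulVec, dotProduct]
      rw [hexp]
      refine AEMeasurable.aestronglyMeasurable ?_
      refine Finset.aemeasurable_fun_sum _ fun i _ => ?_
      refine AEMeasurable.mul ?_ (Finset.aemeasurable_fun_sum _ fun j _ => ?_)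
      · exact (continuous_polyFun _).measurable.aemeasurable
      · exact (hA.aemeasurable i j).mul (continuous_polyFun _).measurable.aemeasurable
    · filter_upwards [hA.upper] with x hx
      refine (norm_inner_le_norm _ _).trans ?_
      exact mul_le_mul_of_nonneg_right (hx _) (norm_nonneg _)
  refine h.congr ?_
  filter_upwards [ae_gradient_eq hp, ae_gradient_eq hq] with x hx hy
  rw [hx, hy]

lemma IsPolyOn.integrableOn_bForm (hA : IsCoefficient (cell s) α β A) (hu : IsPolyOn s u)
    (hv : IsPolyOn s v) : IntegrableOn (fun x =>
      inner ℝ (Matrix.toEuclideanLin (A x) (gradient u x)) (gradient v x) +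
        lam ^ 2 * (u x * v x)) (cell s) :=
  (hu.integrableOn_aForm hA hv).add ((hu.integrableOn_mul hv).const_mul _)

lemma IsPolyOn.bForm_eq_integral (hA : IsCoefficient (cell s) α β A) (hu : IsPolyOn s u)
    (hv : IsPolyOn s v) : bForm A lam (cell s) u v = ∫ x in cell s,
      (inner ℝ (Matrix.toEuclideanLin (A x) (gradient u x)) (gradient v x) +
        lam ^ 2 * (u x * v x)) := by
  rw [integral_add (hu.integrableOn_aForm hA hv) ((hu.integrableOn_mul hv).const_mul _),
    integral_const_mul]
  rfl

lemma IsPolyOn.integrableOn_sq (hu : IsPolyOn s u) : IntegrableOn (fun x => u x ^ 2) (cell s) := by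
  simpa only [sq] using hu.integrableOn_mul hu

lemma IsPolyOn.h1NormSq_eq_integral (hu : IsPolyOn s u) : h1NormSq β lam (cell s) u =
    ∫ x in cell s, (β * ‖gradient u x‖ ^ 2 + lam ^ 2 * u x ^ 2) := by
  rw [integral_add (hu.integrableOn_gradient_sq.const_mul _) (hu.integrableOn_sq.const_mul _),
    integral_const_mul, integral_const_mul]
  rfl

/-- Young's inequality for the bilinear form. -/
lemma IsPolyOn.neg_bForm_le (hA : IsCoefficient (cell s) α β A) (hβ : 0 ≤ β) (hu : IsPolyOn s u)
    (hv : IsPolyOn s v) {θ : ℝ} (hθ : 0 < θ) : -bForm A lam (cell s) u v ≤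
      θ / 2 * h1NormSq β lam (cell s) u + 1 / (2 * θ) * h1NormSq β lam (cell s) v := by
  have hyoung : ∀ a b : ℝ, a * b ≤ θ / 2 * a ^ 2 + 1 / (2 * θ) * b ^ 2 := by
    intro a b
    have h : θ / 2 * a ^ 2 + 1 / (2 * θ) * b ^ 2 - a * b = 1 / (2 * θ) * (θ * a - b) ^ 2 := by
      field_simp
      ring
    have : 0 ≤ 1 / (2 * θ) * (θ * a - b) ^ 2 := by positivity
    linarith
  rw [hu.bForm_eq_integral hA hv, hu.h1NormSq_eq_integral, hv.h1NormSq_eq_integral,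
    ← integral_neg, ← integral_const_mul, ← integral_const_mul, ← integral_add]
  · refine integral_mono_ae ?_ ?_ ?_
    · exact (hu.integrableOn_bForm hA hv).neg
    · exact (((hu.integrableOn_gradient_sq.const_mul _).add
        (hu.integrableOn_sq.const_mul _)).const_mul _).add
        (((hv.integrableOn_gradient_sq.const_mul _).add
        (hv.integrableOn_sq.const_mul _)).const_mul _)
    · filter_upwards [hA.upper] with x hx
      have h1 := neg_le_of_abs_le (abs_real_inner_le_norm
        (Matrix.toEuclideanLin (A x) (gradient u x)) (gradient v x))
      have h2 := mul_le_mul_of_nonneg_right (hx (gradient u x)) (norm_nonneg (gradient v x))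
      have h3 := mul_le_mul_of_nonneg_left (hyoung ‖gradient u x‖ ‖gradient v x‖) hβ
      have h4 := mul_le_mul_of_nonneg_left (hyoung (-u x) (v x)) (sq_nonneg lam)
      simp only [neg_sq] at h4
      linarith
  · exact ((hu.integrableOn_gradient_sq.const_mul _).add
      (hu.integrableOn_sq.const_mul _)).const_mul _
  · exact ((hv.integrableOn_gradient_sq.const_mul _).add
      (hv.integrableOn_sq.const_mul _)).const_mul _

lemma IsPolyOn.mul_gradient_sq_le (hA : IsCoefficient (cell s) α β A) (hu : IsPolyOn s u) :
    α * (∫ x in cell s, ‖gradient u x‖ ^ 2) ≤ aForm A (cell s) u u := by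
  rw [← integral_const_mul]
  refine integral_mono_ae (hu.integrableOn_gradient_sq.const_mul _)
    (hu.integrableOn_aForm hA hu) ?_
  filter_upwards [hA.lower] with x hx using hx _

lemma l2Form_self (S : Set (Pt d)) (u : Pt d → ℝ) : l2Form S u u = ∫ x in S, u x ^ 2 := by
  simp only [l2Form, sq]

/-- Coercivity: the energy controls the gradient and the function. -/
lemma IsPolyOn.le_energyNormSq (hA : IsCoefficient (cell s) α β A) (hu : IsPolyOn s u) :
    α * (∫ x in cell s, ‖gradient u x‖ ^ 2) + lam ^ 2 * (∫ x in cell s, u x ^ 2) ≤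
      energyNormSq A lam (cell s) u := by
  rw [energyNormSq, l2Form_self]
  exact add_le_add_left (hu.mul_gradient_sq_le hA) _

lemma IsPolyOn.energyNormSq_nonneg (hα : 0 < α) (hA : IsCoefficient (cell s) α β A)
    (hu : IsPolyOn s u) : 0 ≤ energyNormSq A lam (cell s) u := by
  refine le_trans ?_ (hu.le_energyNormSq hA)
  have h1 : 0 ≤ ∫ x in cell s, ‖gradient u x‖ ^ 2 := integral_nonneg fun _ => sq_nonneg _
  have h2 : 0 ≤ ∫ x in cell s, u x ^ 2 := integral_nonneg fun _ => sq_nonneg _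
  positivity

lemma IsPolyOn.h1NormSq_le (hα : 0 < α) (hA : IsCoefficient (cell s) α β A) (hu : IsPolyOn s u) :
    h1NormSq β lam (cell s) u ≤ max 1 (β / α) * energyNormSq A lam (cell s) u := by
  refine le_trans ?_ (mul_le_mul_of_nonneg_left (hu.le_energyNormSq hA)
    (zero_le_one.trans (le_max_left _ _)))
  have h1 : 0 ≤ ∫ x in cell s, ‖gradient u x‖ ^ 2 := integral_nonneg fun _ => sq_nonneg _
  have h2 : 0 ≤ lam ^ 2 * ∫ x in cell s, u x ^ 2 :=
    mul_nonneg (sq_nonneg _) (integral_nonneg fun _ => sq_nonneg _)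
  rw [h1NormSq, mul_add, ← mul_assoc]
  refine add_le_add (mul_le_mul_of_nonneg_right ?_ h1)
    (le_mul_of_one_le_left h2 (le_max_left _ _))
  rw [← div_le_iff₀ hα]
  exact le_max_right _ _

/-- The inverse estimate for the weighted `H¹` norm in terms of the maximum. -/
lemma h1NormSq_le_of_abs_le {k : ℕ} {p : MvPolynomial (Fin d) ℝ} (hp : p.totalDegree ≤ k)
    (hv : ∀ x ∈ cell s, v x = polyFun p x) {S : ℝ} (hS : ∀ x ∈ cell s, |v x| ≤ S)
    {c : Pt d} {r : ℝ} (hr : 0 < r) (hball : Metric.closedBall c r ⊆ cell s) (hβ : 0 ≤ β) :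
    h1NormSq β lam (cell s) v ≤
      (β * (markovConst k / r) ^ 2 + lam ^ 2) * (S ^ 2 * volume.real (cell s)) := by
  have hfin : volume (cell s) < ⊤ := (isCompact_cell s).measure_lt_top
  have hpoly : IsPolyOn s v := ⟨p, hv⟩
  have h1 : (∫ x in cell s, ‖gradient v x‖ ^ 2) ≤
      (markovConst k * S / r) ^ 2 * volume.real (cell s) := by
    rw [mul_comm, ← smul_eq_mul, ← setIntegral_const]
    refine integral_mono_ae hpoly.integrableOn_gradient_sq (integrableOn_const hfin.ne) ?_
    filter_upwards [ae_gradient_eq hv, ae_restrict_mem (isCompact_cell s).measurableSet]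
      with x hx hxs
    rw [hx]
    exact pow_le_pow_left₀ (norm_nonneg _) (norm_polyGrad_le hp (convex_cell s)
      (fun y hy => by rw [← hv y hy]; exact hS y hy) hr hball hxs) 2
  have h2 : (∫ x in cell s, v x ^ 2) ≤ S ^ 2 * volume.real (cell s) := by
    rw [mul_comm, ← smul_eq_mul, ← setIntegral_const]
    refine setIntegral_mono_on hpoly.integrableOn_sq (integrableOn_const hfin.ne)
      (isCompact_cell s).measurableSet fun x hx => ?_
    rw [← sq_abs]
    exact pow_le_pow_left₀ (abs_nonneg _) (hS x hx) 2
  calc h1NormSq β lam (cell s) v ≤ β * ((markovConst k * S / r) ^ 2 * volume.real (cell s)) +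
        lam ^ 2 * (S ^ 2 * volume.real (cell s)) :=
        add_le_add (mul_le_mul_of_nonneg_left h1 hβ)
          (mul_le_mul_of_nonneg_left h2 (sq_nonneg _))
    _ = _ := by ring

/-- Subtracting a constant from the test function does not change the form if the zeroth order term
does not see the constant. -/
lemma bForm_eq_energyNormSq_of_eq_sub {c : ℝ} (hc : lam ^ 2 * c = 0)
    (hv : ∀ x ∈ cell s, v x = u x - c) :
    bForm A lam (cell s) u v = energyNormSq A lam (cell s) u := by
  have h1 : aForm A (cell s) u v = aForm A (cell s) u u := by
    refine integral_congr_ae ?_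
    filter_upwards [ae_cell_mem_interior s] with x hx
    have heq : v =ᶠ[nhds x] fun y => u y - c := by
      filter_upwards [mem_interior_iff_mem_nhds.1 hx] with y hy using hv y hy
    have hg : gradient v x = gradient u x := by
      rw [gradient, gradient, heq.fderiv_eq, fderiv_sub_const]
    rw [hg]
  have h2 : lam ^ 2 * l2Form (cell s) u v = lam ^ 2 * l2Form (cell s) u u := by
    rw [l2Form, l2Form, ← integral_const_mul, ← integral_const_mul]
    refine setIntegral_congr_fun (isCompact_cell s).measurableSet fun x hx => ?_
    simp only [hv x hx]
    linear_combination (-u x) * hc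
  rw [energyNormSq_eq_bForm, bForm, bForm, h1, h2]

lemma bForm_eq_zero_of_eq_zero (hv : ∀ x ∈ cell s, v x = 0) : bForm A lam (cell s) u v = 0 := by
  have h1 : aForm A (cell s) u v = 0 := by
    refine integral_eq_zero_of_ae ?_
    filter_upwards [ae_cell_mem_interior s] with x hx
    have heq : v =ᶠ[nhds x] fun _ => (0 : ℝ) := by
      filter_upwards [mem_interior_iff_mem_nhds.1 hx] with y hy using hv y hy
    have hg : gradient v x = 0 := by
      rw [gradient, heq.fderiv_eq, fderiv_const_apply, map_zero]
    rw [hg, inner_zero_right]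
    rfl
  have h2 : l2Form (cell s) u v = 0 := by
    refine setIntegral_eq_zero_of_forall_eq_zero fun x hx => ?_
    rw [hv x hx, mul_zero]
  rw [bForm, h1, h2, mul_zero, add_zero]

end Cell

/-! ### Energy forms on the domain -/

namespace SimplicialMesh

variable {d : ℕ} {Ω : Set (Pt d)} (T : SimplicialMesh Ω) {α β lam : ℝ}
  {A : Pt d → Matrix (Fin d) (Fin d) ℝ} {k : ℕ}

lemma isPolyOn {u : Pt d → ℝ} (hu : u ∈ T.Pk k) {s : Finset (Pt d)} (hs : s ∈ T.cells) :
    IsPolyOn s u := by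
  obtain ⟨p, -, hp⟩ := hu.2 s hs
  exact ⟨p, hp⟩

/-- An integral over the domain is the sum of the integrals over the cells. -/
lemma integral_eq_sum (hΩ : IsPolyhedralDomain Ω) {f : Pt d → ℝ}
    (hf : ∀ s ∈ T.cells, IntegrableOn f (cell s)) :
    IntegrableOn f Ω ∧ ∫ x in Ω, f x = ∑ s ∈ T.cells, ∫ x in cell s, f x := by
  have hU : closure Ω = ⋃ s : T.cells, cell (s : Finset (Pt d)) := by
    rw [← T.iUnion_eq]
    exact (Set.iUnion_subtype (· ∈ T.cells) fun s => cell (s : Finset (Pt d))).symm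
  have hae : (Ω : Set (Pt d)) =ᵐ[volume] closure Ω := by
    rw [closure_eq_self_union_frontier]
    exact (union_ae_eq_left_of_ae_eq_empty (ae_eq_empty.2 (T.volume_frontier_eq_zero hΩ))).symm
  have hint : IntegrableOn f (⋃ s : T.cells, cell (s : Finset (Pt d))) :=
    integrableOn_finite_iUnion.2 fun s => hf s s.2
  refine ⟨(hU ▸ hint : IntegrableOn f (closure Ω)).congr_set_ae hae, ?_⟩
  rw [setIntegral_congr_set hae, hU, integral_iUnion_ae
    (fun s => (isCompact_cell _).measurableSet.nullMeasurableSet) (fun s t hst => ?_) hint,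
    tsum_fintype, Finset.sum_coe_sort T.cells fun s => ∫ x in cell s, f x]
  exact T.volume_inter_eq_zero s.2 t.2 fun h => hst (Subtype.ext h)

lemma bForm_eq_sum (hΩ : IsPolyhedralDomain Ω) (hA : IsCoefficient Ω α β A) {u v : Pt d → ℝ}
    (hu : u ∈ T.Pk k) (hv : v ∈ T.Pk k) :
    bForm A lam Ω u v = ∑ s ∈ T.cells, bForm A lam (cell s) u v := by
  have h1 := (T.integral_eq_sum hΩ fun s hs =>
    (T.isPolyOn hu hs).integrableOn_aForm (T.isCoefficient_cell hΩ hs hA) (T.isPolyOn hv hs)).2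
  have h2 := (T.integral_eq_sum hΩ fun s hs =>
    (T.isPolyOn hu hs).integrableOn_mul (T.isPolyOn hv hs)).2
  simp only [bForm, Finset.sum_add_distrib, ← Finset.mul_sum]
  rw [aForm, h1, l2Form, h2]
  rfl

/-- Galerkin orthogonality in terms of the full solution. -/
lemma IsSolution.bForm_eq_zero {T : SimplicialMesh Ω} (hΩ : IsPolyhedralDomain Ω)
    (hA : IsCoefficient Ω α β A) {uhg uh v : Pt d → ℝ} (hg : uhg ∈ T.Pk k)
    (h : T.IsSolution k A lam uhg uh) (hv : v ∈ T.PkZero k) : bForm A lam Ω uh v = 0 := by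
  have hsol : bForm A lam Ω (uh - uhg) v + bForm A lam Ω uhg v = 0 := by
    have := h.2.2 v hv
    rw [bForm, bForm]
    linarith
  rw [← hsol, T.bForm_eq_sum hΩ hA h.1 hv.1, T.bForm_eq_sum hΩ hA h.2.1.1 hv.1,
    T.bForm_eq_sum hΩ hA hg hv.1, ← Finset.sum_add_distrib]
  refine Finset.sum_congr rfl fun s hs => ?_
  have hAs := T.isCoefficient_cell hΩ hs hA
  have pu := T.isPolyOn h.1 hs
  have pg := T.isPolyOn hg hs
  have p0 := T.isPolyOn h.2.1.1 hs
  have pv := T.isPolyOn hv.1 hs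
  rw [pu.bForm_eq_integral hAs pv, p0.bForm_eq_integral hAs pv, pg.bForm_eq_integral hAs pv,
    ← integral_add (p0.integrableOn_bForm hAs pv) (pg.integrableOn_bForm hAs pv)]
  refine integral_congr_ae ?_
  obtain ⟨p, hp⟩ := pu
  obtain ⟨q, hq⟩ := pg
  filter_upwards [ae_cell_mem_interior s] with x hx
  have hdiff : ∀ (w : Pt d → ℝ) (r : MvPolynomial (Fin d) ℝ),
      (∀ x ∈ cell s, w x = polyFun r x) → DifferentiableAt ℝ w x := by
    intro w r hw
    have heq : w =ᶠ[nhds x] polyFun r := by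
      filter_upwards [mem_interior_iff_mem_nhds.1 hx] with y hy using hw y hy
    exact ((hasGradientAt_polyFun r x).congr_of_eventuallyEq heq).differentiableAt
  have hgrad : gradient (uh - uhg) x = gradient uh x - gradient uhg x := by
    rw [gradient, gradient, gradient, fderiv_sub (hdiff _ p hp) (hdiff _ q hq), map_sub]
  simp only [hgrad, map_sub, inner_sub_left, Pi.sub_apply]
  ring

end SimplicialMesh

/-! ### Locally constant approximation on touching sets -/

/-- Let the oscillation of `u` on each set of a finite family be at most `O`, and let `u` vanish on
`Z`. Then `u` differs by at most the number of sets times `O` from constants that agree on touching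
sets and are zero on the sets that meet `Z`: on each connected component of the touching relation,
take a value of `u`, at a point of `Z` if possible. -/
lemma exists_locally_constant {ι X : Type*} (P : Finset ι) (S : ι → Set X)
    (hS : ∀ i ∈ P, (S i).Nonempty) (u : X → ℝ) {O : ℝ} (hO0 : 0 ≤ O)
    (hO : ∀ i ∈ P, ∀ x ∈ S i, ∀ y ∈ S i, |u x - u y| ≤ O) (Z : Set X)
    (hZ : ∀ i ∈ P, ∀ x ∈ S i, x ∈ Z → u x = 0) :
    ∃ c : ι → ℝ, (∀ i ∈ P, ∀ j ∈ P, (S i ∩ S j).Nonempty → c i = c j) ∧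
      (∀ i ∈ P, (S i ∩ Z).Nonempty → c i = 0) ∧
      ∀ i ∈ P, ∀ x ∈ S i, |u x - c i| ≤ P.card * O := by
  classical
  let G : SimpleGraph P := SimpleGraph.fromRel fun i j => (S i ∩ S j).Nonempty
  have hwalk : ∀ {i j : P} (w : G.Walk i j), ∀ x ∈ S i, ∀ y ∈ S j,
      |u x - u y| ≤ (w.length + 1) * O := by
    intro i j w
    induction w with
    | nil =>
      intro x hx y hy
      simpa using hO _ (Subtype.coe_prop _) x hx y hy
    | @cons i l j hadj w ih =>
      intro x hx y hy
      obtain ⟨z, hz1, hz2⟩ : (S i ∩ S l).Nonempty := by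
        rcases ((SimpleGraph.fromRel_adj _ _ _).1 hadj).2 with h | h
        · exact h
        · rwa [Set.inter_comm]
      have h1 := hO i i.2 x hx z hz1
      have h2 := ih z hz2 y hy
      have h3 := abs_sub_le (u x) (u z) (u y)
      rw [SimpleGraph.Walk.length_cons]
      push_cast
      linarith
  have hrep : ∀ C : G.ConnectedComponent, ∃ x, (∃ i : P, G.connectedComponentMk i = C ∧ x ∈ S i) ∧
      ((∃ i : P, G.connectedComponentMk i = C ∧ (S i ∩ Z).Nonempty) → x ∈ Z) := by
    intro C
    by_cases h : ∃ i : P, G.connectedComponentMk i = C ∧ (S i ∩ Z).Nonempty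
    · obtain ⟨i, hi, x, hx, hxZ⟩ := h
      exact ⟨x, ⟨i, hi, hx⟩, fun _ => hxZ⟩
    · obtain ⟨i, rfl⟩ := C.exists_rep
      obtain ⟨x, hx⟩ := hS i i.2
      exact ⟨x, ⟨i, rfl, hx⟩, fun h' => absurd h' h⟩
  choose f hf hfZ using hrep
  refine ⟨fun i => if h : i ∈ P then u (f (G.connectedComponentMk ⟨i, h⟩)) else 0, ?_, ?_, ?_⟩
  · intro i hi j hj hij
    simp only [hi, hj, dif_pos]
    congr 2
    rw [SimpleGraph.ConnectedComponent.eq]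
    by_cases h : i = j
    · subst h; rfl
    · exact SimpleGraph.Adj.reachable ((SimpleGraph.fromRel_adj _ _ _).2
        ⟨fun h' => h (congrArg Subtype.val h'), Or.inl hij⟩)
  · intro i hi hiZ
    simp only [hi, dif_pos]
    obtain ⟨j, -, hj⟩ := hf (G.connectedComponentMk ⟨i, hi⟩)
    exact hZ j j.2 _ hj (hfZ _ ⟨⟨i, hi⟩, rfl, hiZ⟩)
  · intro i hi x hx
    simp only [hi, dif_pos]
    obtain ⟨j, hj, hfj⟩ := hf (G.connectedComponentMk ⟨i, hi⟩)
    obtain ⟨w⟩ := SimpleGraph.ConnectedComponent.eq.1 hj.symm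
    have h1 := hwalk (i := ⟨i, hi⟩) (w.toPath : G.Walk _ _) x hx _ hfj
    have h2 := w.toPath.2.length_lt
    rw [Fintype.card_coe] at h2
    refine h1.trans (mul_le_mul_of_nonneg_right ?_ hO0)
    exact_mod_cast h2

/-! ### Patches -/

namespace SimplicialMesh

variable {d : ℕ} {Ω : Set (Pt d)} (T : SimplicialMesh Ω) {D : Finset (Finset (Pt d))}

lemma mem_patch_succ {l : ℕ} {s : Finset (Pt d)} : s ∈ T.patch D (l + 1) ↔
    s ∈ T.cells ∧ ∃ t ∈ T.patch D l, (cell s ∩ cell t).Nonempty := by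
  simp [patch]

lemma patch_subset_cells (hD : D ⊆ T.cells) (l : ℕ) : T.patch D l ⊆ T.cells := by
  cases l with
  | zero => exact hD
  | succ l => exact fun s hs => (T.mem_patch_succ.1 hs).1

lemma patch_subset_succ (hD : D ⊆ T.cells) (l : ℕ) : T.patch D l ⊆ T.patch D (l + 1) := by
  intro s hs
  have hsc := T.patch_subset_cells hD l hs
  refine T.mem_patch_succ.2 ⟨hsc, s, hs, ?_⟩
  rw [Set.inter_self]
  exact (T.isSimplex hsc).cell_nonempty

lemma patch_mono (hD : D ⊆ T.cells) : Monotone (T.patch D) :=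
  monotone_nat_of_le_succ (T.patch_subset_succ hD)

/-- The lifting vanishes on the patches of size at most `lmax`, including their boundary points. -/
lemma IsMaxPatchSize.eq_zero {T : SimplicialMesh Ω} (hD : D ⊆ T.cells) {k : ℕ} {uhg : Pt d → ℝ}
    (hg : uhg ∈ T.Pk k) {lmax : ℕ} (hmax : T.IsMaxPatchSize D uhg lmax) {l : ℕ} (hl : l ≤ lmax)
    {s : Finset (Pt d)} (hs : s ∈ T.patch D l) {x : Pt d} (hx : x ∈ cell s) : uhg x = 0 := by
  by_contra hne
  have hempty := hmax.1 s (T.patch_mono hD hl hs)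
  have hxc := T.cell_subset (T.patch_subset_cells hD l hs) hx
  have hmem : x ∈ supportIn Ω uhg := by
    have hev : ∀ᶠ y in nhdsWithin x Ω, uhg y ≠ 0 :=
      ((hg.1 x hxc).mono subset_closure).eventually_ne hne
    rw [supportIn, mem_closure_iff_frequently]
    have hfr : ∃ᶠ y in nhdsWithin x Ω, uhg y ≠ 0 := by
      have := mem_closure_iff_nhdsWithin_neBot.1 hxc
      exact hev.frequently
    rw [frequently_nhdsWithin_iff] at hfr
    exact hfr.mono fun y hy => ⟨hy.2, hy.1⟩
  exact (Set.eq_empty_iff_forall_notMem.1 hempty x) ⟨hx, hmem⟩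

/-! ### Reduction of the energy in one layer -/

/-- The reduction factor that results from a bound `C` for the test function and a bound `κ` for the
continuity of the bilinear form relative to the energy. -/
def reductionFactor (κ C : ℝ) : ℝ := (C * κ / 2 + 1 / 2) / (C * κ / 2 + 1)

lemma reductionFactor_mem {κ C : ℝ} (hκ : 0 < κ) (hC : 0 < C) :
    0 < reductionFactor κ C ∧ reductionFactor κ C < 1 := by
  have h : 0 < C * κ / 2 := by positivity
  constructor
  · unfold reductionFactor; positivity
  · rw [reductionFactor, div_lt_one (by positivity)]
    linarith

open Classical in
/-- Testing the discrete equation with a function `v` that differs from `u` by constants on the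
inner cells `P₀` and vanishes outside the larger set `P₁` of cells bounds the energy in `P₀` by
integrals over the layer `P₁ \ P₀`. With Young's inequality, weighted such that the test function
contributes half of the energy in `P₁`, this gives a reduction factor less than one. -/
lemma energy_le_reductionFactor_mul (hΩ : IsPolyhedralDomain Ω) {α β lam : ℝ} (hα : 0 < α)
    (hβ : 0 ≤ β) {A : Pt d → Matrix (Fin d) (Fin d) ℝ} (hA : IsCoefficient Ω α β A) {k : ℕ}
    {u v : Pt d → ℝ} (hu : u ∈ T.Pk k) (hv : v ∈ T.Pk k) (hortho : bForm A lam Ω u v = 0)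
    {P₀ P₁ : Finset (Finset (Pt d))} (h01 : P₀ ⊆ P₁) (h1 : P₁ ⊆ T.cells)
    (c : Finset (Pt d) → ℝ) (hc : ∀ s, lam ^ 2 * c s = 0)
    (hin : ∀ s ∈ P₀, ∀ x ∈ cell s, v x = u x - c s)
    (hout : ∀ s ∈ T.cells, s ∉ P₁ → ∀ x ∈ cell s, v x = 0) {C : ℝ} (hC : 0 < C)
    (hbound : ∑ s ∈ P₁ \ P₀, h1NormSq β lam (cell s) v ≤
      C * ∑ s ∈ P₁, energyNormSq A lam (cell s) u) :
    ∑ s ∈ P₀, energyNormSq A lam (cell s) u ≤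
      reductionFactor (max 1 (β / α)) C * ∑ s ∈ P₁, energyNormSq A lam (cell s) u := by
  set κ := max 1 (β / α) with hκ
  have hκ0 : 0 < κ := zero_lt_one.trans_le (le_max_left _ _)
  set E₀ := ∑ s ∈ P₀, energyNormSq A lam (cell s) u with hE₀
  set E₁ := ∑ s ∈ P₁, energyNormSq A lam (cell s) u with hE₁
  have hsplit : ∑ s ∈ P₁ \ P₀, bForm A lam (cell s) u v + E₀ = 0 := by
    rw [← hortho, T.bForm_eq_sum hΩ hA hu hv, ← Finset.sum_subset h1 fun s hs hs1 =>
      bForm_eq_zero_of_eq_zero (hout s hs hs1), ← Finset.sum_sdiff h01]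
    congr 1
    exact Finset.sum_congr rfl fun s hs =>
      (bForm_eq_energyNormSq_of_eq_sub (hc s) (hin s hs)).symm
  have hlayer : ∑ s ∈ P₁ \ P₀, energyNormSq A lam (cell s) u + E₀ = E₁ := Finset.sum_sdiff h01
  have hcell : ∀ s ∈ P₁ \ P₀, -bForm A lam (cell s) u v ≤
      C * κ / 2 * energyNormSq A lam (cell s) u + 1 / (2 * C) * h1NormSq β lam (cell s) v := by
    intro s hs
    have hsc := h1 (Finset.mem_sdiff.1 hs).1
    have hAs := T.isCoefficient_cell hΩ hsc hA
    have pu := T.isPolyOn hu hsc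
    -- The weight `C` in Young's inequality balances the bound `C * E₁` for the test function.
    have e1 := pu.neg_bForm_le (lam := lam) hAs hβ (T.isPolyOn hv hsc) hC
    have e2 := mul_le_mul_of_nonneg_left (pu.h1NormSq_le (lam := lam) hα hAs)
      (by positivity : 0 ≤ C / 2)
    rw [← hκ] at e2
    linarith
  have hsum := Finset.sum_le_sum hcell
  rw [Finset.sum_neg_distrib, Finset.sum_add_distrib, ← Finset.mul_sum, ← Finset.mul_sum] at hsum
  have hb := mul_le_mul_of_nonneg_left hbound (by positivity : 0 ≤ 1 / (2 * C))
  have hb' : 1 / (2 * C) * (C * E₁) = E₁ / 2 := by field_simp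
  rw [hb'] at hb
  have hpos : 0 < C * κ / 2 := by positivity
  have hfin : (C * κ / 2 + 1) * E₀ ≤ (C * κ / 2 + 1 / 2) * E₁ := by
    have : ∑ s ∈ P₁ \ P₀, energyNormSq A lam (cell s) u = E₁ - E₀ := by linarith
    rw [this] at hsum
    linarith
  rw [reductionFactor, div_mul_eq_mul_div, le_div_iff₀ (by positivity)]
  linarith

/-! ### Cell sizes -/

lemma cells_nonempty (hΩ : IsPolyhedralDomain Ω) : T.cells.Nonempty := by
  obtain ⟨x, hx⟩ := hΩ.isConnected.nonempty
  obtain ⟨s, hs, -⟩ := T.exists_mem_cell (subset_closure hx)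
  exact ⟨s, hs⟩

/-- In a shape-regular mesh of positive dimension every cell contains a ball of a radius that is
bounded below in terms of the smallest cell diameter. -/
lemma ShapeRegular.exists_closedBall_subset {T : SimplicialMesh Ω} (hd : 1 ≤ d) {σ : ℝ}
    (hT : T.ShapeRegular σ) {s : Finset (Pt d)} (hs : s ∈ T.cells) :
    0 < T.hMin / (2 * σ) ∧ ∃ c r, T.hMin / (2 * σ) ≤ r ∧ Metric.closedBall c r ⊆ cell s := by
  have hpos : ∀ t ∈ T.cells, 0 < Metric.diam (cell t) := by
    intro t ht
    obtain ⟨c, r, hr, hball, -⟩ := hT t ht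
    have hn : ‖EuclideanSpace.single (⟨0, hd⟩ : Fin d) r‖ = r := by
      rw [PiLp.norm_single, Real.norm_of_nonneg hr.le]
    have hdist := Metric.dist_le_diam_of_mem (isCompact_cell t).isBounded
      (hball (show c + EuclideanSpace.single (⟨0, hd⟩ : Fin d) r ∈ _ by simp [abs_of_pos hr]))
      (hball (Metric.mem_closedBall_self hr.le))
    rw [dist_eq_norm, add_sub_cancel_left, hn] at hdist
    exact hr.trans_le hdist
  have hmem : T.hMin ∈ (fun s : Finset (Pt d) => Metric.diam (cell s)) ''
      (T.cells : Set (Finset (Pt d))) :=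
    Set.Nonempty.csInf_mem ⟨_, s, hs, rfl⟩ (T.cells.finite_toSet.image _)
  have hmin0 : 0 < T.hMin := by
    obtain ⟨t, ht, hte⟩ := hmem
    rw [← hte]
    exact hpos t ht
  have hle : T.hMin ≤ Metric.diam (cell s) :=
    csInf_le (T.cells.finite_toSet.image _).bddBelow ⟨s, hs, rfl⟩
  obtain ⟨c, r, hr, hball, hdiam⟩ := hT s hs
  have hσ : 0 < σ := by
    have h := (hpos s hs).trans_le hdiam
    exact pos_of_mul_pos_left h (by positivity)
  refine ⟨by positivity, c, r, ?_, hball⟩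
  rw [div_le_iff₀ (by positivity)]
  linarith

lemma sum_volume_cells (hΩ : IsPolyhedralDomain Ω) :
    ∑ s ∈ T.cells, volume.real (cell s) = volume.real Ω := by
  have h := (T.integral_eq_sum hΩ (f := fun _ => (1 : ℝ)) fun s _ =>
    integrableOn_const (isCompact_cell s).measure_lt_top.ne).2
  simpa using h.symm

/-! ### Bounds for the test function -/

/-- The constant for a positive zeroth order term; `r` is a lower bound for the inradius. -/
def massConst (d k : ℕ) (β lam r : ℝ) : ℝ :=
  supConst d k * (β * (markovConst k / r) ^ 2 / lam ^ 2 + 1)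

/-- For `λ > 0` the test function is controlled cell by cell, since the energy contains the `L²`
norm. -/
lemma h1NormSq_le_massConst_mul {α β lam : ℝ} (hα : 0 < α) (hβ : 0 ≤ β) (hlam : 0 < lam) {k : ℕ}
    {A : Pt d → Matrix (Fin d) (Fin d) ℝ} {s : Finset (Pt d)} (hs : s ∈ T.cells)
    (hA : IsCoefficient (cell s) α β A) {u v : Pt d → ℝ} (hu : u ∈ T.Pk k) (hv : v ∈ T.Pk k)
    (huv : ∀ S, (∀ x ∈ cell s, |u x| ≤ S) → ∀ x ∈ cell s, |v x| ≤ S)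
    {r₀ : ℝ} (hr₀ : 0 < r₀) {c : Pt d} {r : ℝ} (hr : r₀ ≤ r)
    (hball : Metric.closedBall c r ⊆ cell s) :
    h1NormSq β lam (cell s) v ≤ massConst d k β lam r₀ * energyNormSq A lam (cell s) u := by
  obtain ⟨p, hp, hup⟩ := hu.2 s hs
  obtain ⟨q, hq, hvq⟩ := hv.2 s hs
  change ∀ x ∈ cell s, u x = polyFun p x at hup
  have hball₀ : Metric.closedBall c r₀ ⊆ cell s :=
    (Metric.closedBall_subset_closedBall hr).trans hball
  obtain ⟨x₀, hx₀, hmax⟩ := (isCompact_cell s).exists_isMaxOn (T.isSimplex hs).cell_nonempty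
    ((continuous_polyFun p).abs.continuousOn)
  have h1 := h1NormSq_le_of_abs_le (lam := lam) hq hvq
    (huv |polyFun p x₀| fun x hx => by rw [hup x hx]; exact hmax hx) hr₀ hball₀ hβ
  have h2 := sq_mul_volume_le hp (convex_cell s) (isCompact_cell s) hx₀
  have h3 : ∫ y in cell s, polyFun p y ^ 2 = ∫ y in cell s, u y ^ 2 :=
    setIntegral_congr_fun (isCompact_cell s).measurableSet fun y hy => by simp only [hup y hy]
  have h4 := (T.isPolyOn hu hs).le_energyNormSq (lam := lam) hA
  have h5 : 0 ≤ α * ∫ x in cell s, ‖gradient u x‖ ^ 2 :=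
    mul_nonneg hα.le (integral_nonneg fun _ => sq_nonneg _)
  have h6 : lam ^ 2 * (∫ y in cell s, u y ^ 2) ≤ energyNormSq A lam (cell s) u := by linarith
  rw [sq_abs] at h1
  rw [h3] at h2
  have hS := supConst_pos d k
  calc h1NormSq β lam (cell s) v
      ≤ (β * (markovConst k / r₀) ^ 2 + lam ^ 2) *
          (supConst d k * ∫ y in cell s, u y ^ 2) :=
        h1.trans (mul_le_mul_of_nonneg_left h2 (by positivity))
    _ = massConst d k β lam r₀ * (lam ^ 2 * ∫ y in cell s, u y ^ 2) := by
        rw [massConst]; field_simp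
    _ ≤ _ := mul_le_mul_of_nonneg_left h6 (by unfold massConst; positivity)

/-- The constant without zeroth order term. Here `V` is the volume of the domain, `δ` its diameter,
`w` a lower bound for the volume of a cell, so that `V / w` bounds the number of cells, and `r` a
lower bound for the inradius. The summand `1` only makes it positive. -/
def chainConst (d k : ℕ) (α β V δ w r : ℝ) : ℝ :=
  1 + β * (markovConst k / r) ^ 2 * V * ((V / w) ^ 2 * (supConst d k * δ ^ 2 / w)) / α

/-- For `λ = 0`, subtract from `u` a constant on each connected component of the union of the cells
in `P`, which is zero on components that touch the boundary. By summing oscillations along chains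
of cells the difference is bounded by the `L²` norm of the gradient on all of `P`. -/
lemma exists_constants_sub_le (hΩ : IsPolyhedralDomain Ω) {k : ℕ} {u : Pt d → ℝ} (hu : u ∈ T.Pk k)
    {P : Finset (Finset (Pt d))} (hP : P ⊆ T.cells)
    (hbd : ∀ s ∈ P, ∀ x ∈ cell s, x ∈ frontier Ω → u x = 0) {w : ℝ} (hw : 0 < w)
    (hvol : ∀ s ∈ T.cells, w ≤ volume.real (cell s)) :
    ∃ c : Finset (Pt d) → ℝ, (∀ s ∈ P, ∀ t ∈ P, (cell s ∩ cell t).Nonempty → c s = c t) ∧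
      (∀ s ∈ P, (cell s ∩ frontier Ω).Nonempty → c s = 0) ∧
      ∀ s ∈ P, ∀ x ∈ cell s, |u x - c s| ≤ volume.real Ω / w *
        √(supConst d k * Metric.diam (closure Ω) ^ 2 / w *
          ∑ t ∈ P, ∫ y in cell t, ‖gradient u y‖ ^ 2) := by
  set δ := Metric.diam (closure Ω) with hδ
  set G := ∑ t ∈ P, ∫ y in cell t, ‖gradient u y‖ ^ 2 with hG
  have hS := supConst_pos d k
  have hg0 : ∀ t, 0 ≤ ∫ y in cell t, ‖gradient u y‖ ^ 2 :=
    fun t => integral_nonneg fun _ => sq_nonneg _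
  have hG0 : 0 ≤ G := Finset.sum_nonneg fun t _ => hg0 t
  have hosc : ∀ s ∈ P, ∀ x ∈ cell s, ∀ y ∈ cell s,
      |u x - u y| ≤ √(supConst d k * δ ^ 2 / w * G) := by
    intro s hs x hx y hy
    obtain ⟨p, hp, hup⟩ := hu.2 s (hP hs)
    change ∀ x ∈ cell s, u x = polyFun p x at hup
    refine Real.abs_le_sqrt ?_
    have h1 := sub_sq_mul_volume_le hp (convex_cell s) (isCompact_cell s) hy hx
    have h2 : ∫ z in cell s, ‖polyGrad p z‖ ^ 2 = ∫ z in cell s, ‖gradient u z‖ ^ 2 :=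
      integral_congr_ae (by filter_upwards [ae_gradient_eq hup] with z hz; rw [hz])
    have h3 : ‖x - y‖ ≤ δ := by
      rw [← dist_eq_norm]
      exact Metric.dist_le_diam_of_mem hΩ.isBounded.closure (T.cell_subset (hP hs) hx)
        (T.cell_subset (hP hs) hy)
    have h4 : ∫ z in cell s, ‖gradient u z‖ ^ 2 ≤ G :=
      Finset.single_le_sum (f := fun t => ∫ y in cell t, ‖gradient u y‖ ^ 2)
        (fun t _ => hg0 t) hs
    rw [h2, ← hup x hx, ← hup y hy] at h1
    have h5 : (u x - u y) ^ 2 * w ≤ (u x - u y) ^ 2 * volume.real (cell s) :=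
      mul_le_mul_of_nonneg_left (hvol s (hP hs)) (sq_nonneg _)
    have h6 : supConst d k * ‖x - y‖ ^ 2 * (∫ z in cell s, ‖gradient u z‖ ^ 2) ≤
        supConst d k * δ ^ 2 * G := by
      have := hg0 s
      gcongr
    rw [div_mul_eq_mul_div, le_div_iff₀ hw]
    linarith
  obtain ⟨c, hc1, hc2, hc3⟩ := exists_locally_constant P cell
    (fun s hs => (T.isSimplex (hP hs)).cell_nonempty) u (Real.sqrt_nonneg _) hosc (frontier Ω) hbd
  refine ⟨c, hc1, hc2, fun s hs x hx => (hc3 s hs x hx).trans ?_⟩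
  refine mul_le_mul_of_nonneg_right ?_ (Real.sqrt_nonneg _)
  rw [le_div_iff₀ hw, ← T.sum_volume_cells hΩ]
  calc (P.card : ℝ) * w = ∑ _s ∈ P, w := by rw [Finset.sum_const, nsmul_eq_mul]
    _ ≤ ∑ s ∈ P, volume.real (cell s) := Finset.sum_le_sum fun s hs => hvol s (hP hs)
    _ ≤ _ := Finset.sum_le_sum_of_subset_of_nonneg hP fun _ _ _ => measureReal_nonneg

lemma sum_h1NormSq_le_chainConst_mul (hΩ : IsPolyhedralDomain Ω) {α β : ℝ} (hα : 0 < α)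
    (hβ : 0 ≤ β) {A : Pt d → Matrix (Fin d) (Fin d) ℝ} (hA : IsCoefficient Ω α β A) {k : ℕ}
    {u v : Pt d → ℝ} (hu : u ∈ T.Pk k) (hv : v ∈ T.Pk k) {P Q : Finset (Finset (Pt d))}
    (hP : P ⊆ T.cells) (hQ : Q ⊆ P) {w δ : ℝ} (hw : 0 < w)
    (hvS : ∀ s ∈ P, ∀ x ∈ cell s, |v x| ≤ volume.real Ω / w *
        √(supConst d k * δ ^ 2 / w * ∑ t ∈ P, ∫ y in cell t, ‖gradient u y‖ ^ 2))
    {r₀ : ℝ} (hr₀ : 0 < r₀)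
    (hball : ∀ s ∈ T.cells, ∃ c, Metric.closedBall c r₀ ⊆ cell s) :
    ∑ s ∈ Q, h1NormSq β 0 (cell s) v ≤ chainConst d k α β (volume.real Ω) δ w r₀ *
      ∑ s ∈ P, energyNormSq A 0 (cell s) u := by
  set G := ∑ t ∈ P, ∫ y in cell t, ‖gradient u y‖ ^ 2 with hG
  set S := volume.real Ω / w * √(supConst d k * δ ^ 2 / w * G) with hSdef
  set E := ∑ s ∈ P, energyNormSq A 0 (cell s) u with hE
  have hsup := supConst_pos d k
  have hG0 : 0 ≤ G := Finset.sum_nonneg fun t _ => integral_nonneg fun _ => sq_nonneg _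
  have hGE : G ≤ E / α := by
    rw [le_div_iff₀ hα, mul_comm, hG, Finset.mul_sum]
    refine Finset.sum_le_sum fun s hs => ?_
    have := (T.isPolyOn hu (hP hs)).le_energyNormSq (lam := 0)
      (T.isCoefficient_cell hΩ (hP hs) hA)
    linarith
  have hE0 : 0 ≤ E := by
    have := hG0.trans hGE
    rwa [le_div_iff₀ hα, zero_mul] at this
  have hV : 0 ≤ volume.real Ω := measureReal_nonneg
  have hS2 : S ^ 2 = (volume.real Ω / w) ^ 2 * (supConst d k * δ ^ 2 / w) * G := by
    rw [hSdef, mul_pow, Real.sq_sqrt (by positivity)]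
    ring
  have hQvol : ∑ s ∈ Q, volume.real (cell s) ≤ volume.real Ω := by
    rw [← T.sum_volume_cells hΩ]
    exact Finset.sum_le_sum_of_subset_of_nonneg (hQ.trans hP) fun _ _ _ => measureReal_nonneg
  have hcell : ∀ s ∈ Q, h1NormSq β 0 (cell s) v ≤
      β * (markovConst k / r₀) ^ 2 * S ^ 2 * volume.real (cell s) := by
    intro s hs
    obtain ⟨q, hq, hvq⟩ := hv.2 s (hP (hQ hs))
    obtain ⟨c, hc⟩ := hball s (hP (hQ hs))
    have := h1NormSq_le_of_abs_le (lam := 0) hq hvq (hvS s (hQ hs)) hr₀ hc hβ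
    linarith
  calc ∑ s ∈ Q, h1NormSq β 0 (cell s) v
      ≤ ∑ s ∈ Q, β * (markovConst k / r₀) ^ 2 * S ^ 2 * volume.real (cell s) :=
        Finset.sum_le_sum hcell
    _ ≤ β * (markovConst k / r₀) ^ 2 * S ^ 2 * volume.real Ω := by
        rw [← Finset.mul_sum]
        exact mul_le_mul_of_nonneg_left hQvol (by positivity)
    _ = β * (markovConst k / r₀) ^ 2 * volume.real Ω *
          ((volume.real Ω / w) ^ 2 * (supConst d k * δ ^ 2 / w)) * G := by
        rw [hS2]; ring
    _ ≤ β * (markovConst k / r₀) ^ 2 * volume.real Ω *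
          ((volume.real Ω / w) ^ 2 * (supConst d k * δ ^ 2 / w)) * (E / α) :=
        mul_le_mul_of_nonneg_left hGE (by positivity)
    _ ≤ _ := by
        rw [chainConst, add_mul, one_mul, div_mul_eq_mul_div, mul_div_assoc _ E]
        exact le_add_of_nonneg_left hE0

/-! ### Decay of the energy -/

/-- The constant that enters the reduction factor. -/
def layerConst (k : ℕ) (σ α β lam hmin : ℝ) (Ω : Set (Pt d)) : ℝ :=
  if 0 < lam then massConst d k β lam (hmin / (2 * σ))
  else chainConst d k α β (volume.real Ω) (Metric.diam (closure Ω))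
    (volume.real (Metric.closedBall (0 : Pt d) (hmin / (2 * σ)))) (hmin / (2 * σ))

lemma layerConst_pos (k : ℕ) (σ lam hmin : ℝ) {α β : ℝ} (hα : 0 < α) (hβ : 0 < β)
    (Ω : Set (Pt d)) : 0 < layerConst k σ α β lam hmin Ω := by
  have h1 := supConst_pos d k
  have h2 : 0 ≤ volume.real Ω := measureReal_nonneg
  have h3 : 0 ≤ volume.real (Metric.closedBall (0 : Pt d) (hmin / (2 * σ))) := measureReal_nonneg
  rw [layerConst]
  split_ifs
  · unfold massConst; positivity
  · unfold chainConst; positivity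

/-- The energy in a patch is at most a fixed fraction of the energy in the next larger patch, as
long as the solution has zero boundary values on the latter. -/
lemma energy_le_mul_energy_succ (hd : 1 ≤ d) {k : ℕ} (hk : 1 ≤ k) {σ α β lam : ℝ} (hα : 0 < α)
    (hβ : 0 < β) (hlam : 0 ≤ lam) (hΩ : IsPolyhedralDomain Ω) (hT : T.ShapeRegular σ)
    {A : Pt d → Matrix (Fin d) (Fin d) ℝ} (hA : IsCoefficient Ω α β A) {u : Pt d → ℝ}
    (hu : u ∈ T.Pk k) (hortho : ∀ v ∈ T.PkZero k, bForm A lam Ω u v = 0) (hD : D ⊆ T.cells)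
    {l : ℕ} (hbd : ∀ s ∈ T.patch D (l + 1), ∀ x ∈ cell s, x ∈ frontier Ω → u x = 0) :
    T.energy A lam u D l ≤
      reductionFactor (max 1 (β / α)) (layerConst k σ α β lam T.hMin Ω) *
        T.energy A lam u D (l + 1) := by
  classical
  set V : Finset (Pt d) := (T.patch D l).biUnion id with hV
  have hsubV : ∀ s ∈ T.patch D l, s ⊆ V := fun s hs => Finset.subset_biUnion_of_mem id hs
  have hmeet : ∀ s ∈ T.cells, ¬Disjoint s V → s ∈ T.patch D (l + 1) := by
    intro s hs hsV
    obtain ⟨a, has, haV⟩ := Finset.not_disjoint_iff.1 hsV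
    obtain ⟨t, ht, hat⟩ := Finset.mem_biUnion.1 haV
    exact T.mem_patch_succ.2 ⟨hs, t, ht, a, subset_convexHull ℝ _ has, subset_convexHull ℝ _ hat⟩
  have h01 := T.patch_subset_succ hD l
  have h1 := T.patch_subset_cells hD (l + 1)
  have hC := layerConst_pos k σ lam T.hMin hα hβ Ω
  rcases hlam.eq_or_lt with rfl | hpos
  · have hr : 0 < T.hMin / (2 * σ) := by
      obtain ⟨s, hs⟩ := T.cells_nonempty hΩ
      exact (hT.exists_closedBall_subset hd hs).1
    set r₀ := T.hMin / (2 * σ) with hr₀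
    have hball : ∀ s ∈ T.cells, ∃ c, Metric.closedBall c r₀ ⊆ cell s := by
      intro s hs
      obtain ⟨-, c, r, hr, hc⟩ := hT.exists_closedBall_subset hd hs
      exact ⟨c, (Metric.closedBall_subset_closedBall hr).trans hc⟩
    set w := volume.real (Metric.closedBall (0 : Pt d) r₀) with hwdef
    have hw : 0 < w := ENNReal.toReal_pos (Metric.measure_closedBall_pos _ _ hr).ne'
      measure_closedBall_lt_top.ne
    have hvol : ∀ s ∈ T.cells, w ≤ volume.real (cell s) := by
      intro s hs
      obtain ⟨c, hc⟩ := hball s hs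
      rw [hwdef, measureReal_def, ← Measure.addHaar_closedBall_center volume c, ← measureReal_def]
      exact measureReal_mono hc (isCompact_cell s).measure_lt_top.ne
    obtain ⟨c, hc1, hc2, hc3⟩ := T.exists_constants_sub_le hΩ hu h1 hbd hw hvol
    obtain ⟨v, hv, hvin, hvout, hvS⟩ := T.exists_cutoff hΩ hk hu V c
      (fun s hs t ht hsV htV hst => hc1 s (hmeet s hs hsV) t (hmeet t ht htV) hst)
      (fun s hs hsV x hx hxΩ => ⟨hbd s (hmeet s hs hsV) x hx hxΩ,
        hc2 s (hmeet s hs hsV) ⟨x, hx, hxΩ⟩⟩)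
    refine T.energy_le_reductionFactor_mul hΩ hα hβ.le hA hu hv.1 (hortho v hv) h01 h1 c
      (by simp) (fun s hs => hvin s (h1 (h01 hs)) (hsubV s hs))
      (fun s hs hs1 => hvout s hs (by_contra fun h => hs1 (hmeet s hs h))) hC ?_
    rw [layerConst, if_neg (lt_irrefl _)]
    exact T.sum_h1NormSq_le_chainConst_mul hΩ hα hβ.le hA hu hv.1 h1 Finset.sdiff_subset hw
      (fun s hs => hvS s (h1 hs) _ (hc3 s hs)) hr hball
  · obtain ⟨v, hv, hvin, hvout, hvS⟩ := T.exists_cutoff hΩ hk hu V (fun _ => 0)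
      (fun _ _ _ _ _ _ _ => rfl)
      (fun s hs hsV x hx hxΩ => ⟨hbd s (hmeet s hs hsV) x hx hxΩ, rfl⟩)
    simp only [sub_zero] at hvS
    refine T.energy_le_reductionFactor_mul hΩ hα hβ.le hA hu hv.1 (hortho v hv) h01 h1 (fun _ => 0)
      (by simp) (fun s hs => hvin s (h1 (h01 hs)) (hsubV s hs))
      (fun s hs hs1 => hvout s hs (by_contra fun h => hs1 (hmeet s hs h))) hC ?_
    rw [Finset.mul_sum]
    refine (Finset.sum_le_sum (g := fun s => layerConst k σ α β lam T.hMin Ω *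
      energyNormSq A lam (cell s) u) fun s hs => ?_).trans
      (Finset.sum_le_sum_of_subset_of_nonneg Finset.sdiff_subset fun s hs _ => ?_)
    · have hsc := h1 (Finset.mem_sdiff.1 hs).1
      obtain ⟨hr₀, c, r, hr, hc⟩ := hT.exists_closedBall_subset hd hsc
      rw [layerConst, if_pos hpos]
      exact T.h1NormSq_le_massConst_mul hα hβ.le hpos hsc (T.isCoefficient_cell hΩ hsc hA) hu hv.1
        (hvS s hsc) hr₀ hr hc
    · exact mul_nonneg hC.le ((T.isPolyOn hu (h1 hs)).energyNormSq_nonneg hα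
        (T.isCoefficient_cell hΩ (h1 hs) hA))

lemma energy_le_energyNormSq (hΩ : IsPolyhedralDomain Ω) {α β lam : ℝ} (hα : 0 < α)
    {A : Pt d → Matrix (Fin d) (Fin d) ℝ} (hA : IsCoefficient Ω α β A) {k : ℕ} {u : Pt d → ℝ}
    (hu : u ∈ T.Pk k) (hD : D ⊆ T.cells) (l : ℕ) :
    T.energy A lam u D l ≤ energyNormSq A lam Ω u := by
  rw [energyNormSq_eq_bForm, T.bForm_eq_sum hΩ hA hu hu]
  exact Finset.sum_le_sum_of_subset_of_nonneg (T.patch_subset_cells hD l) fun s hs _ =>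
    (T.isPolyOn hu hs).energyNormSq_nonneg hα (T.isCoefficient_cell hΩ hs hA)

end SimplicialMesh

end FEM

end

theorem mainTheorem2 (d k : ℕ) (hd : 1 ≤ d) (hk : 1 ≤ k)
    (σ α β lam hmin : ℝ) (hα : 0 < α) (hβ : 0 < β) (hlam : 0 ≤ lam) :
    ∃ ρ : Set (FEM.Pt d) → ℝ,
      (∀ Ω, 0 < ρ Ω ∧ ρ Ω < 1) ∧
      (0 < lam → ∀ Ω Ω', ρ Ω = ρ Ω') ∧
      ∀ Ω : Set (FEM.Pt d), FEM.IsPolyhedralDomain Ω →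
      ∀ T : FEM.SimplicialMesh Ω, T.ShapeRegular σ → T.hMin = hmin →
      ∀ Γ : Set (FEM.Pt d), Γ ⊆ frontier Ω → (0 < lam ∨ (frontier Ω \ Γ).Nonempty) →
      ∀ A : FEM.Pt d → Matrix (Fin d) (Fin d) ℝ, FEM.IsCoefficient Ω α β A →
      ∀ (gh : frontier Ω → ℝ) (uhg uh : FEM.Pt d → ℝ),
        T.IsLifting k gh uhg → T.IsSolution k A lam uhg uh →
      ∀ D : Finset (Finset (FEM.Pt d)), D ⊆ T.cells → FEM.Suitable Γ D →
      ∀ lmax : ℕ, T.IsMaxPatchSize D uhg lmax →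
        (∀ l : ℕ, l < lmax → T.energy A lam uh D l ≤ ρ Ω * T.energy A lam uh D (l + 1)) ∧
        T.energy A lam uh D 0 ≤ ρ Ω ^ lmax * T.energy A lam uh D lmax ∧
        ρ Ω ^ lmax * T.energy A lam uh D lmax ≤
          ρ Ω ^ lmax * FEM.energyNormSq A lam Ω uh := by
  have hκ : 0 < max 1 (β / α) := zero_lt_one.trans_le (le_max_left _ _)
  refine ⟨fun Ω => FEM.SimplicialMesh.reductionFactor (max 1 (β / α))
    (FEM.SimplicialMesh.layerConst k σ α β lam hmin Ω), fun Ω =>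
    FEM.SimplicialMesh.reductionFactor_mem hκ
      (FEM.SimplicialMesh.layerConst_pos k σ lam hmin hα hβ Ω), fun hpos Ω Ω' => ?_, ?_⟩
  · simp only [FEM.SimplicialMesh.layerConst, if_pos hpos]
  intro Ω hΩ T hT hTmin Γ _ _ A hA gh uhg uh hg hsol D hD _ lmax hmax
  subst hTmin
  set ρ := FEM.SimplicialMesh.reductionFactor (max 1 (β / α))
    (FEM.SimplicialMesh.layerConst k σ α β lam T.hMin Ω)
  have hρ : 0 < ρ := (FEM.SimplicialMesh.reductionFactor_mem hκ
    (FEM.SimplicialMesh.layerConst_pos k σ lam T.hMin hα hβ Ω)).1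
  have hstep : ∀ l : ℕ, l < lmax → T.energy A lam uh D l ≤ ρ * T.energy A lam uh D (l + 1) := by
    intro l hl
    refine T.energy_le_mul_energy_succ hd hk hα hβ hlam hΩ hT hA hsol.1
      (fun v hv => hsol.bForm_eq_zero hΩ hA hg.1 hv) hD fun s hs x hx hxΩ => ?_
    have h0 := hsol.2.1.2 x hxΩ
    rw [Pi.sub_apply, hmax.eq_zero hD hg.1 hl hs hx, sub_zero] at h0
    exact h0
  refine ⟨hstep, ?_, mul_le_mul_of_nonneg_left (T.energy_le_energyNormSq hΩ hα hA hsol.1 hD lmax)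
    (pow_nonneg hρ.le _)⟩
  have hiter : ∀ l ≤ lmax, T.energy A lam uh D 0 ≤ ρ ^ l * T.energy A lam uh D l := by
    intro l
    induction l with
    | zero => simp
    | succ l ih =>
      intro hl
      refine (ih (by omega)).trans ?_
      rw [pow_succ, mul_assoc]
      exact mul_le_mul_of_nonneg_left (hstep l hl) (pow_nonneg hρ.le _)
  exact hiter lmax le_rfl
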